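/- Identify $\mathbb{R}^3$ with the reduced quaternions $\mathcal{A}=\mathrm{span}_{\mathbb{R}}\{1,\mathbf{e}_1,\mathbf{e}_2\}\subset\mathbb{H}$, let $B$ be the open unit ball of $\mathbb{R}^3$, and let $D=\partial_{x_0}+\mathbf{e}_1\partial_{x_1}+\mathbf{e}_2\partial_{x_2}$, $\overline{D}=\partial_{x_0}-\mathbf{e}_1\partial_{x_1}-\mathbf{e}_2\partial_{x_2}$. A $C^1$ function $\mathbf{f}:B\to\mathcal{A}$ is monogenic if $D\mathbf{f}=0$ in $B$, and a hyperholomorphic constant if moreover $\tfrac12\overline{D}\mathbf{f}=0$ in $B$. On $L_2(B;\mathcal{A};\mathbb{R})$ use the real inner product $\langle \mathbf{f},\mathbf{g}\rangle=\int_B \mathbf{Sc}(\overline{\mathbf{f}}\,\mathbf{g})\,dV$. Put $t=x_0/|x|$, $c=x_1/\sqrt{x_1^2+x_2^2}$, $s=x_2/\sqrt{x_1^2+x_2^2}$. Let $P_n^l(t)=(1-t^2)^{l/2}\frac{d^l}{dt^l}P_n(t)$ $(l\ge 0)$ be the associated Legendre functions, $P_n^{-1}=-\frac{1}{n(n+1)}P_n^1$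 for $n\ge1$ and $P_0^{-1}=0$, and let $T_l,U_l$ be the Chebyshev polynomials of the first and second kind (extended to negative indices by their recurrence). Define the homogeneous monogenic polynomials $$\mathbf{X}_n^{l,\dagger}(x)=|x|^n\Big\{\tfrac{n+l+1}{2}P_n^l(t)T_l(c)+\tfrac14P_n^{l+1}(t)\big[T_{l+1}(c)\mathbf{e}_1+sU_l(c)\mathbf{e}_2\big]+\tfrac14(n+l+1)(n+l)P_n^{l-1}(t)\big[-T_{l-1}(c)\mathbf{e}_1+sU_{l-2}(c)\mathbf{e}_2\big]\Big\}$$ for $0\le l\le n+1$, and $$\mathbf{Y}_n^{m,\dagger}(x)=|x|^n\Big\{\tfrac{n+m+1}{2}P_n^m(t)\,sU_{m-1}(c)+\tfrac14P_n^{m+1}(t)\big[sU_m(c)\mathbf{e}_1-T_{m+1}(c)\mathbf{e}_2\big]-\tfrac14(n+m+1)(n+m)P_n^{m-1}(t)\big[sU_{m-2}(c)\mathbf{e}_1+T_{m-1}(c)\mathbf{e}_2\big]\Big\}$$ for $1\le m\le n+1$. Let $\mathbf{X}_n^{l,\dagger,\ast}$ and $\mathbf{Y}_n^{m,\dagger,\ast}$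 be these polynomials normalized in $L_2(B;\mathcal{A};\mathbb{R})$. **Theorem 4.1.** Let $\mathbf{f}:B\to\mathcal{A}$ be monogenic with $|\mathbf{f}(x)|<1$ in $B$, and suppose that $\mathbf{f}-\mathbf{f}(0)$ is orthogonal to all hyperholomorphic constants in $L_2(B;\mathcal{A};\mathbb{R})$. Let $a_n^l=\langle\mathbf{X}_n^{l,\dagger,\ast},\mathbf{f}\rangle$ and $b_n^m=\langle\mathbf{Y}_n^{m,\dagger,\ast},\mathbf{f}\rangle$ be the Fourier coefficients of $\mathbf{f}$. Then, for every $0\le r<0.026$ and every $x$ with $|x|\le r$, $$\sum_{n=0}^{\infty}\Big[|\mathbf{X}_n^{0,\dagger,\ast}(x)|\,|a_n^0|+\sum_{m=1}^{n}\big(|\mathbf{X}_n^{m,\dagger,\ast}(x)|\,|a_n^m|+|\mathbf{Y}_n^{m,\dagger,\ast}(x)|\,|b_n^m|\big)\Big]<1 .$$ In particular the series converges. -/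

import Mathlib

open MeasureTheory Polynomial
open scoped Quaternion

noncomputable section

namespace RieszBohr

/-- The Euclidean space `ℝ³`, with coordinates `x 0, x 1, x 2`. -/
abbrev E3 : Type := EuclideanSpace ℝ (Fin 3)

/-- The open unit ball of `ℝ³`. -/
def B : Set E3 := Metric.ball 0 1

/-- The imaginary unit `e₁`. -/
def e1 : ℍ[ℝ] := ⟨0, 1, 0, 0⟩

/-- The imaginary unit `e₂`. -/
def e2 : ℍ[ℝ] := ⟨0, 0, 1, 0⟩

/-- The real vector space `𝒜 = span_ℝ {1, e₁, e₂}` of reduced quaternions. -/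
def reduced : Submodule ℝ ℍ[ℝ] := Submodule.span ℝ {1, e1, e2}

/-- The partial derivative `∂f/∂xᵢ`. -/
def partialD (i : Fin 3) (f : E3 → ℍ[ℝ]) (x : E3) : ℍ[ℝ] :=
  fderiv ℝ f x (EuclideanSpace.single i 1)

/-- The generalized Cauchy-Riemann operator `D = ∂₀ + e₁ ∂₁ + e₂ ∂₂`. -/
def cauchyRiemann (f : E3 → ℍ[ℝ]) (x : E3) : ℍ[ℝ] :=
  partialD 0 f x + e1 * partialD 1 f x + e2 * partialD 2 f x

/-- The conjugate operator `∂₀ - e₁ ∂₁ - e₂ ∂₂`. -/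
def conjCauchyRiemann (f : E3 → ℍ[ℝ]) (x : E3) : ℍ[ℝ] :=
  partialD 0 f x - e1 * partialD 1 f x - e2 * partialD 2 f x

/-- The hypercomplex derivative, one half of the conjugate Cauchy-Riemann operator. -/
def hypercomplexDeriv (f : E3 → ℍ[ℝ]) (x : E3) : ℍ[ℝ] :=
  (1 / 2 : ℝ) • conjCauchyRiemann f x

/-- `𝒜`-valued monogenic functions on an open set `Ω`: the `C¹` functions with values in the
reduced quaternions and `D f = 0` on `Ω`. Only the values of `f` on `Ω` matter. -/
structure IsMonogenicOn (f : E3 → ℍ[ℝ]) (Ω : Set E3) : Prop where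
  mem_reduced : ∀ x ∈ Ω, f x ∈ reduced
  contDiffOn : ContDiffOn ℝ 1 f Ω
  cauchyRiemann_eq_zero : ∀ x ∈ Ω, cauchyRiemann f x = 0

/-- Hyperholomorphic constants: monogenic functions whose hypercomplex derivative vanishes. -/
structure IsHyperholomorphicConstOn (f : E3 → ℍ[ℝ]) (Ω : Set E3) : Prop where
  isMonogenicOn : IsMonogenicOn f Ω
  hypercomplexDeriv_eq_zero : ∀ x ∈ Ω, hypercomplexDeriv f x = 0

/-- The real inner product `∫_B Sc (conj f * g) dV`. -/
def innerL2 (f g : E3 → ℍ[ℝ]) : ℝ := ∫ x in B, (star (f x) * g x).re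

/-- The norm of `L₂(B; 𝒜; ℝ)`. -/
def normL2 (f : E3 → ℍ[ℝ]) : ℝ := √(innerL2 f f)

/-- `f` is orthogonal to all hyperholomorphic constants that lie in `L₂(B; 𝒜; ℝ)`. -/
def OrthogonalToConstants (f : E3 → ℍ[ℝ]) : Prop :=
  ∀ h : E3 → ℍ[ℝ], IsHyperholomorphicConstOn h B → MemLp h 2 (volume.restrict B) →
    innerL2 f h = 0

/-- The Legendre polynomial `Pₙ`, by Rodrigues' formula. -/
def legendre (n : ℕ) : ℝ[X] :=
  C (1 / (2 ^ n * (n.factorial : ℝ))) * derivative^[n] ((X ^ 2 - 1) ^ n)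

/-- The associated Legendre function `Pₙˡ(t) = (1 - t²)^{l/2} (d/dt)ˡ Pₙ(t)` for `l ≥ 0`
(without the sign `(-1)ˡ`; with that sign the functions below would not be monogenic). -/
def assocLegendre (n l : ℕ) (t : ℝ) : ℝ :=
  √(1 - t ^ 2) ^ l * (derivative^[l] (legendre n)).eval t

/-- `Pₙˡ⁻¹(t)` for `l ≥ 0`, where `Pₙ⁻¹ = - Pₙ¹ / (n (n + 1))` (and `P₀⁻¹ = 0`). -/
def assocLegendrePred (n : ℕ) : ℕ → ℝ → ℝ
  | 0, t => -(1 / ((n : ℝ) * (n + 1))) * assocLegendre n 1 t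
  | l + 1, t => assocLegendre n l t

/-- `x₀ / |x|`. -/
def cosTheta (x : E3) : ℝ := x 0 / ‖x‖

/-- `x₁ / √(x₁² + x₂²)`. -/
def cosPhi (x : E3) : ℝ := x 1 / √(x 1 ^ 2 + x 2 ^ 2)

/-- `x₂ / √(x₁² + x₂²)`. -/
def sinPhi (x : E3) : ℝ := x 2 / √(x 1 ^ 2 + x 2 ^ 2)

/-- The value at `t` of the Chebyshev polynomial of the first kind. -/
def chebT (l : ℤ) (t : ℝ) : ℝ := (Chebyshev.T ℝ l).eval t

/-- The value at `t` of the Chebyshev polynomial of the second kind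
(so `U₋₁ = 0` and `U₋₂ = -1`). -/
def chebU (l : ℤ) (t : ℝ) : ℝ := (Chebyshev.U ℝ l).eval t

/-- The homogeneous monogenic polynomial `X_n^{l,†}`, `0 ≤ l ≤ n + 1`. On the axis `x₁ = x₂ = 0`
and at the origin the quotients above are `0` by convention; there they are multiplied by `0`,
or the factor containing them is constant, so the formula gives the polynomial everywhere. -/
def XPoly (n l : ℕ) (x : E3) : ℍ[ℝ] :=
  ‖x‖ ^ n •
    (⟨((n : ℝ) + l + 1) / 2 * assocLegendre n l (cosTheta x) * chebT l (cosPhi x),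
      1 / 4 * assocLegendre n (l + 1) (cosTheta x) * chebT (l + 1) (cosPhi x)
        - 1 / 4 * ((n : ℝ) + l + 1) * (n + l) * assocLegendrePred n l (cosTheta x)
            * chebT (l - 1) (cosPhi x),
      1 / 4 * assocLegendre n (l + 1) (cosTheta x) * (sinPhi x * chebU l (cosPhi x))
        + 1 / 4 * ((n : ℝ) + l + 1) * (n + l) * assocLegendrePred n l (cosTheta x)
            * (sinPhi x * chebU (l - 2) (cosPhi x)),
      0⟩ : ℍ[ℝ])

/-- The homogeneous monogenic polynomial `Y_n^{m,†}`, `1 ≤ m ≤ n + 1`. -/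
def YPoly (n m : ℕ) (x : E3) : ℍ[ℝ] :=
  ‖x‖ ^ n •
    (⟨((n : ℝ) + m + 1) / 2 * assocLegendre n m (cosTheta x)
        * (sinPhi x * chebU (m - 1) (cosPhi x)),
      1 / 4 * assocLegendre n (m + 1) (cosTheta x) * (sinPhi x * chebU m (cosPhi x))
        - 1 / 4 * ((n : ℝ) + m + 1) * (n + m) * assocLegendrePred n m (cosTheta x)
            * (sinPhi x * chebU (m - 2) (cosPhi x)),
      -(1 / 4 * assocLegendre n (m + 1) (cosTheta x) * chebT (m + 1) (cosPhi x))
        - 1 / 4 * ((n : ℝ) + m + 1) * (n + m) * assocLegendrePred n m (cosTheta x)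
            * chebT (m - 1) (cosPhi x),
      0⟩ : ℍ[ℝ])

/-- The function `F` normalized in `L₂(B; 𝒜; ℝ)`. -/
def normalized (F : E3 → ℍ[ℝ]) (x : E3) : ℍ[ℝ] := (normL2 F)⁻¹ • F x

/-- The normalized basis polynomial `X_n^{l,†,*}`. -/
def XStar (n l : ℕ) : E3 → ℍ[ℝ] := normalized (XPoly n l)

/-- The normalized basis polynomial `Y_n^{m,†,*}`. -/
def YStar (n m : ℕ) : E3 → ℍ[ℝ] := normalized (YPoly n m)

/-- The Fourier coefficient `a_n^l` of `f`. -/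
def coeffA (f : E3 → ℍ[ℝ]) (n l : ℕ) : ℝ := innerL2 (XStar n l) f

/-- The Fourier coefficient `b_n^m` of `f`. -/
def coeffB (f : E3 → ℍ[ℝ]) (n m : ℕ) : ℝ := innerL2 (YStar n m) f

/-- The degree `n` part of the Bohr sum, every summand taken in modulus:
`|X_n^{0,†,*}| |a_n^0| + ∑_{m=1}^n (|X_n^{m,†,*}| |a_n^m| + |Y_n^{m,†,*}| |b_n^m|)`. -/
def bohrTerm (f : E3 → ℍ[ℝ]) (x : E3) (n : ℕ) : ℝ :=
  ‖XStar n 0 x‖ * |coeffA f n 0|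
    + ∑ m ∈ Finset.Icc 1 n,
        (‖XStar n m x‖ * |coeffA f n m| + ‖YStar n m x‖ * |coeffB f n m|)

end RieszBohr

end

open MeasureTheory Polynomial
open scoped Quaternion ContDiff

noncomputable section

namespace RieszBohr

/-! Write `f = f₀ + f₁ e₁ + f₂ e₂`. The equation `D f = 0` says exactly that `F = (f₀, -f₁, -f₂)` is
divergence free and curl free (`IsMonogenicOn.isHarmonicField`), and each basis polynomial is
likewise the quaternion conjugate of the gradient of a solid harmonic `G` (`XPoly_eq_conjGrad`,
`YPoly_eq_conjGrad`). A Fourier coefficient is therefore, up to normalization, `∫ ∇G · F` over the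
ball.

The decisive identity, `IsAxial.setIntegral_eq`, says that for `G` of degree `n + 1` and order `m`
this pairing only sees the scalar components: `((n+1)² - m²) ∫ ∇G · F = (2n+1)(n+1) ∫ ∂₀G f₀`. It is
applied with `F` from `f` and with `F = ∇G`, so the factor `(n+1)² - m²`, positive for `m ≤ n`,
cancels between the coefficient and the squared norm. Only the scalar harmonic function `u = f₀`,
with `|u| ≤ 1`, remains.

For `n ≥ 1` the function `g = ∂₀G` has mean zero, so `∫ g u = -∫ g (1 - u)`. If `|g| ≤ M p(|x|²)`,
then `1 - u ≥ 0` and the weighted mean value property bound this by `M (1 - u(0)) ∫ p`; replacing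
`u` by `-u` gives the factor `1 - |u(0)|` (`abs_setIntegral_mul_le`). The constant `M` is explicit
in degree one, and in higher degree comes from a pointwise bound on homogeneous harmonic functions
(`sq_mul_le_of_homogeneous`).

Degree zero thus contributes at most `|u(0)|`, degree one at most `12 |x| (1 - |u(0)|)`, and degree
`n ≥ 2` at most `56.7 (15|x|/4)ⁿ (1 - |u(0)|)`. For `|x| ≤ 0.026` the factors of `1 - |u(0)|` add up
to less than `1`, and the total is below `|u(0)| + (1 - |u(0)|) = 1`. -/

/-! ### Partial derivatives and integration by parts on the ball -/

/-- The partial derivative of a real-valued function. -/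
def pd (i : Fin 3) (u : E3 → ℝ) (x : E3) : ℝ := fderiv ℝ u x (EuclideanSpace.single i 1)

lemma isOpen_B : IsOpen B := Metric.isOpen_ball

lemma mem_B {x : E3} : x ∈ B ↔ ‖x‖ < 1 := by simp [B]

lemma contDiff_pd {u : E3 → ℝ} {m n : WithTop ℕ∞} (hu : ContDiff ℝ n u) (hmn : m + 1 ≤ n)
    (i : Fin 3) : ContDiff ℝ m (pd i u) :=
  (hu.fderiv_right hmn).clm_apply contDiff_const

lemma continuousOn_pd {u : E3 → ℝ} (hu : ContDiffOn ℝ 1 u B) (i : Fin 3) :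
    ContinuousOn (pd i u) B :=
  (hu.continuousOn_fderiv_of_isOpen isOpen_B le_rfl).clm_apply continuousOn_const

lemma differentiableAt_of_mem_B {u : E3 → ℝ} (hu : ContDiffOn ℝ 1 u B) {x : E3} (hx : x ∈ B) :
    DifferentiableAt ℝ u x :=
  ((hu.contDiffAt (isOpen_B.mem_nhds hx)).differentiableAt one_ne_zero)

lemma tsupport_pd_subset (u : E3 → ℝ) (i : Fin 3) : tsupport (pd i u) ⊆ tsupport u := by
  refine (closure_mono fun x hx => ?_).trans (tsupport_fderiv_subset ℝ (f := u))
  intro h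
  exact hx (by simp [pd, h])

lemma HasCompactSupport.pd {u : E3 → ℝ} (hu : HasCompactSupport u) (i : Fin 3) :
    HasCompactSupport (RieszBohr.pd i u) :=
  hu.of_isClosed_subset (isClosed_tsupport _) (tsupport_pd_subset u i)

/-- `K` may be arbitrary outside the ball and unbounded near its boundary; the product is still
continuous on the whole space, because continuity only has to be checked on the support of `ψ`. -/
lemma integrable_test_mul {ψ K : E3 → ℝ} (hψ : Continuous ψ) (hc : HasCompactSupport ψ)
    (hs : tsupport ψ ⊆ B) (hK : ContinuousOn K B) : Integrable (fun x => ψ x * K x) := by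
  have hsub : tsupport (fun x => ψ x * K x) ⊆ tsupport ψ := tsupport_mul_subset_left
  have hcont : Continuous (fun x => ψ x * K x) := by
    refine continuous_of_tsupport fun x hx => ?_
    have hxB := hs (hsub hx)
    exact hψ.continuousAt.mul (hK.continuousAt (isOpen_B.mem_nhds hxB))
  exact hcont.integrable_of_hasCompactSupport (hc.mul_right)

/-- Integration by parts against a test function supported in the unit ball. -/
lemma integral_mul_pd {ψ K : E3 → ℝ} (hψ : ContDiff ℝ 1 ψ) (hc : HasCompactSupport ψ)
    (hs : tsupport ψ ⊆ B) (hK : ContDiffOn ℝ 1 K B) (i : Fin 3) :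
    ∫ x, ψ x * pd i K x = -∫ x, pd i ψ x * K x := by
  refine integral_mul_fderiv_eq_neg_fderiv_mul_of_integrable ?_ ?_ ?_ ?_ ?_
  · exact integrable_test_mul (contDiff_pd hψ (m := 0) (by simp) i).continuous
      (HasCompactSupport.pd hc i) ((tsupport_pd_subset ψ i).trans hs) hK.continuousOn
  · exact integrable_test_mul hψ.continuous hc hs (continuousOn_pd hK i)
  · exact integrable_test_mul hψ.continuous hc hs hK.continuousOn
  · exact fun x _ => (hψ.differentiable one_ne_zero) x
  · exact fun x hx => differentiableAt_of_mem_B hK (hs hx)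

lemma pd_comm {u : E3 → ℝ} (hu : ContDiff ℝ ∞ u) (i j : Fin 3) (x : E3) :
    pd i (pd j u) x = pd j (pd i u) x := by
  have h1 : ∀ k l : Fin 3, pd k (pd l u) x =
      fderiv ℝ (fderiv ℝ u) x (EuclideanSpace.single k 1) (EuclideanSpace.single l 1) := by
    intro k l
    have hd : DifferentiableAt ℝ (fderiv ℝ u) x :=
      ((hu.fderiv_right (m := 1) (by norm_cast)).differentiable one_ne_zero) x
    unfold pd
    rw [fderiv_clm_apply hd (by fun_prop)]
    simp
  rw [h1, h1]
  exact (hu.contDiffAt.isSymmSndFDerivAt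
    (by simp only [minSmoothness_of_isRCLikeNormedField]; norm_cast)) _ _

lemma pd_mul {u v : E3 → ℝ} {x : E3} (hu : DifferentiableAt ℝ u x) (hv : DifferentiableAt ℝ v x)
    (i : Fin 3) : pd i (fun y => u y * v y) x = pd i u x * v x + u x * pd i v x := by
  unfold pd
  rw [fderiv_fun_mul hu hv]
  simp only [_root_.add_apply, _root_.smul_apply, smul_eq_mul]
  ring

lemma pd_add {u v : E3 → ℝ} {x : E3} (hu : DifferentiableAt ℝ u x) (hv : DifferentiableAt ℝ v x)
    (i : Fin 3) : pd i (fun y => u y + v y) x = pd i u x + pd i v x := by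
  unfold pd
  rw [fderiv_fun_add hu hv]
  simp

lemma pd_sub {u v : E3 → ℝ} {x : E3} (hu : DifferentiableAt ℝ u x) (hv : DifferentiableAt ℝ v x)
    (i : Fin 3) : pd i (fun y => u y - v y) x = pd i u x - pd i v x := by
  unfold pd
  rw [fderiv_fun_sub hu hv]
  simp

lemma pd_const_mul {u : E3 → ℝ} {x : E3} (hu : DifferentiableAt ℝ u x) (c : ℝ)
    (i : Fin 3) : pd i (fun y => c * u y) x = c * pd i u x := by
  unfold pd
  rw [fderiv_const_mul hu]
  simp

lemma pd_coord (i j : Fin 3) (x : E3) : pd i (fun y => y j) x = if i = j then 1 else 0 := by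
  unfold pd
  have : HasFDerivAt (fun y : E3 => y j) (EuclideanSpace.proj j : E3 →L[ℝ] ℝ) x :=
    (EuclideanSpace.proj j : E3 →L[ℝ] ℝ).hasFDerivAt
  rw [this.fderiv]
  simp [eq_comm]

lemma pd_const (i : Fin 3) (c : ℝ) (x : E3) : pd i (fun _ => c) x = 0 := by
  simp [pd]

/-! ### Radial functions and cutoffs -/

lemma hasFDerivAt_normSq (x : E3) :
    HasFDerivAt (fun y : E3 => ‖y‖ ^ 2) (2 • innerSL ℝ x) x :=
  (hasStrictFDerivAt_norm_sq x).hasFDerivAt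

/-- The partial derivatives of a radial function. -/
lemma pd_radial {η : ℝ → ℝ} {x : E3} (hη : DifferentiableAt ℝ η (‖x‖ ^ 2)) (i : Fin 3) :
    pd i (fun y => η (‖y‖ ^ 2)) x = 2 * x i * deriv η (‖x‖ ^ 2) := by
  unfold pd
  have := hη.hasDerivAt.comp_hasFDerivAt x (hasFDerivAt_normSq x)
  have h2 : HasFDerivAt (fun y : E3 => η (‖y‖ ^ 2)) _ x := this
  rw [h2.fderiv]
  simp [EuclideanSpace.inner_single_right]
  ring

lemma contDiff_radial {η : ℝ → ℝ} {n : WithTop ℕ∞} (hη : ContDiff ℝ n η) :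
    ContDiff ℝ n (fun x : E3 => η (‖x‖ ^ 2)) :=
  hη.comp (contDiff_norm_sq ℝ)

lemma normSq_eq (x : E3) : ‖x‖ ^ 2 = x 0 ^ 2 + x 1 ^ 2 + x 2 ^ 2 := by
  rw [EuclideanSpace.norm_sq_eq, Fin.sum_univ_three]
  simp

lemma tsupport_radial_subset {η : ℝ → ℝ} {c : ℝ} (hc : 0 ≤ c) (hη : ∀ s, c ≤ s → η s = 0)
    (p : E3 → ℝ) :
    tsupport (fun x : E3 => η (‖x‖ ^ 2) * p x) ⊆ Metric.closedBall 0 (√c) := by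
  refine closure_minimal (fun x hx => ?_) Metric.isClosed_closedBall
  by_contra h
  apply hx
  have h1 : √c < ‖x‖ := by simpa using h
  have h2 : c ≤ ‖x‖ ^ 2 := by
    have := Real.sq_sqrt hc
    have h0 := Real.sqrt_nonneg c
    nlinarith
  simp [hη _ h2]

lemma closedBall_sqrt_subset {c : ℝ} (hc1 : c < 1) :
    Metric.closedBall (0 : E3) (√c) ⊆ B := by
  apply Metric.closedBall_subset_ball
  rw [Real.sqrt_lt' one_pos]
  simpa using hc1

lemma hasCompactSupport_radial {η : ℝ → ℝ} {c : ℝ} (hc : 0 ≤ c) (hη : ∀ s, c ≤ s → η s = 0)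
    (p : E3 → ℝ) : HasCompactSupport (fun x : E3 => η (‖x‖ ^ 2) * p x) :=
  (isCompact_closedBall _ _).of_isClosed_subset (isClosed_tsupport _)
    (tsupport_radial_subset hc hη p)

/-- A smooth function vanishing on `[c, ∞)` has a smooth antiderivative vanishing there. -/
lemma exists_antideriv {η : ℝ → ℝ} {c : ℝ} (hη : ContDiff ℝ ∞ η) (h0 : ∀ s, c ≤ s → η s = 0) :
    ∃ A : ℝ → ℝ, ContDiff ℝ ∞ A ∧ (∀ s, deriv A s = η s) ∧ ∀ s, c ≤ s → A s = 0 := by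
  have hd : ∀ s, HasDerivAt (fun s => ∫ y in c..s, η y) (η s) s := fun s =>
    intervalIntegral.integral_hasDerivAt_right (hη.continuous.intervalIntegrable _ _)
      hη.continuous.stronglyMeasurable.stronglyMeasurableAtFilter hη.continuous.continuousAt
  refine ⟨fun s => ∫ y in c..s, η y, ?_, fun s => (hd s).deriv, fun s hs => ?_⟩
  · rw [contDiff_infty_iff_deriv]
    refine ⟨fun s => (hd s).differentiableAt, ?_⟩
    rw [show deriv (fun s => ∫ y in c..s, η y) = η from funext fun s => (hd s).deriv]
    exact hη
  · beta_reduce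
    rw [intervalIntegral.integral_congr (g := fun _ => (0 : ℝ))]
    · simp
    · intro y hy
      rw [Set.uIcc_of_le hs] at hy
      exact h0 y hy.1

/-- Smooth radial profiles increasing to the indicator function of `s < 1`. -/
def cutoff (j : ℕ) (s : ℝ) : ℝ := Real.smoothTransition ((j + 2) * (1 - s) - 1)

lemma contDiff_cutoff (j : ℕ) : ContDiff ℝ ∞ (cutoff j) := by
  unfold cutoff
  exact Real.smoothTransition.contDiff.comp (by fun_prop)

/-- The radius squared beyond which `cutoff j` vanishes. -/
def cutoffRadius (j : ℕ) : ℝ := 1 - 1 / ((j : ℝ) + 2)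

lemma cutoffRadius_pos (j : ℕ) : 0 < cutoffRadius j := by
  unfold cutoffRadius
  have : (0 : ℝ) ≤ j := j.cast_nonneg
  rw [sub_pos, div_lt_one (by positivity)]
  linarith

lemma cutoffRadius_lt_one (j : ℕ) : cutoffRadius j < 1 := by
  unfold cutoffRadius
  have : (0 : ℝ) < 1 / ((j : ℝ) + 2) := by positivity
  linarith

lemma cutoff_eq_zero {j : ℕ} {s : ℝ} (hs : cutoffRadius j ≤ s) : cutoff j s = 0 := by
  unfold cutoff
  apply Real.smoothTransition.zero_of_nonpos
  unfold cutoffRadius at hs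
  have h : (0 : ℝ) < (j : ℝ) + 2 := by positivity
  have h2 : ((j : ℝ) + 2) * (1 / ((j : ℝ) + 2)) = 1 := by field_simp
  nlinarith

lemma tendsto_cutoff {s : ℝ} (hs : s < 1) :
    Filter.Tendsto (fun j => cutoff j s) Filter.atTop (nhds 1) := by
  apply tendsto_const_nhds.congr'
  -- Once `(j + 2)(1 - s) ≥ 2` the argument of the transition function is at least `1`, so the
  -- sequence is eventually constant.
  obtain ⟨N, hN⟩ := exists_nat_ge (2 / (1 - s))
  filter_upwards [Filter.eventually_ge_atTop N] with j hj
  symm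
  apply Real.smoothTransition.one_of_one_le
  have h1 : (0 : ℝ) < 1 - s := by linarith
  rw [div_le_iff₀ h1] at hN
  have h3 : (N : ℝ) ≤ j := by exact_mod_cast hj
  nlinarith

/-- If all truncated integrals vanish, so does the integral over the ball. -/
lemma setIntegral_eq_zero_of_cutoff {k : E3 → ℝ} (hk : IntegrableOn k B)
    (h : ∀ j, ∫ x, cutoff j (‖x‖ ^ 2) * k x = 0) : ∫ x in B, k x = 0 := by
  have hB : ∀ j, ∫ x in B, cutoff j (‖x‖ ^ 2) * k x = 0 := by
    intro j
    rw [setIntegral_eq_integral_of_forall_compl_eq_zero, h j]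
    intro x hx
    have hx1 : 1 ≤ ‖x‖ := by simpa [mem_B] using hx
    rw [cutoff_eq_zero, zero_mul]
    have := cutoffRadius_lt_one j
    nlinarith
  have hlim : Filter.Tendsto (fun j => ∫ x in B, cutoff j (‖x‖ ^ 2) * k x) Filter.atTop
      (nhds (∫ x in B, k x)) := by
    refine tendsto_integral_of_dominated_convergence (fun x => ‖k x‖) ?_ hk.norm ?_ ?_
    · intro j
      exact ((contDiff_cutoff j).continuous.comp
        (continuous_norm.pow 2)).aestronglyMeasurable.mul hk.aestronglyMeasurable
    · intro j
      refine Filter.Eventually.of_forall fun x => ?_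
      rw [norm_mul, Real.norm_eq_abs]
      have h1 : |cutoff j (‖x‖ ^ 2)| ≤ 1 := by
        unfold cutoff
        rw [abs_of_nonneg (Real.smoothTransition.nonneg _)]
        exact Real.smoothTransition.le_one _
      nlinarith [norm_nonneg (k x)]
    · filter_upwards [ae_restrict_mem isOpen_B.measurableSet] with x hx
      have hx1 : ‖x‖ ^ 2 < 1 := by
        rw [mem_B] at hx
        have := norm_nonneg x
        nlinarith
      simpa using (tendsto_cutoff hx1).mul_const (k x)
  simp only [hB] at hlim
  exact (tendsto_nhds_unique hlim tendsto_const_nhds)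

/-! ### Weak harmonicity and the mean value property -/

/-- Harmonicity on the unit ball in the weak sense. -/
def WeaklyHarmonic (v : E3 → ℝ) : Prop :=
  ∀ Φ : E3 → ℝ, ContDiff ℝ ∞ Φ → HasCompactSupport Φ → tsupport Φ ⊆ B →
    ∫ x, ∑ i, pd i Φ x * pd i v x = 0

lemma fderiv_eq_sum_pd (v : E3 → ℝ) (x y : E3) : fderiv ℝ v x y = ∑ i, y i * pd i v x := by
  have hy : y = ∑ i, y i • EuclideanSpace.single i (1 : ℝ) := by
    ext j
    simp [Finset.sum_apply, Pi.single_apply]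
  conv_lhs => rw [hy]
  simp [pd]

/-- The weighted mean over dilated balls has vanishing derivative. -/
lemma integral_radial_mul_fderiv_smul {v : E3 → ℝ} (hw : WeaklyHarmonic v) {η : ℝ → ℝ} {c : ℝ}
    (hη : ContDiff ℝ ∞ η) (hc0 : 0 ≤ c) (hc1 : c < 1) (h0 : ∀ s, c ≤ s → η s = 0)
    {ρ : ℝ} (hρ0 : 0 < ρ) (hρ1 : ρ ≤ 1) :
    ∫ y, η (‖y‖ ^ 2) * fderiv ℝ v (ρ • y) y = 0 := by
  -- After the substitution `x = ρ y` the weight times `xᵢ` is half of `∂ᵢ (A(‖x‖²))`, so the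
  -- integral is a multiple of the weak Laplace equation tested with `A(‖x‖²)`.
  obtain ⟨A, hA, hAd, hA0⟩ := exists_antideriv (η := fun s => η (s / ρ ^ 2)) (c := c)
    (hη.comp (by fun_prop)) (by
      intro s hs
      apply h0
      rw [le_div_iff₀ (by positivity)]
      have : ρ ^ 2 ≤ 1 := by nlinarith
      nlinarith)
  have hsupp := tsupport_radial_subset hc0 hA0 (fun _ => 1)
  have hcomp := hasCompactSupport_radial hc0 hA0 (fun _ => 1)
  simp only [mul_one] at hsupp hcomp
  have key := hw (fun x => A (‖x‖ ^ 2)) (contDiff_radial hA) hcomp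
    (hsupp.trans (closedBall_sqrt_subset hc1))
  have hpd : ∀ x i, pd i (fun x : E3 => A (‖x‖ ^ 2)) x = 2 * x i * η (‖x‖ ^ 2 / ρ ^ 2) := by
    intro x i
    rw [pd_radial ((hA.differentiable (by simp)) _), hAd]
  simp only [hpd] at key
  have hscale := Measure.integral_comp_smul (volume : Measure E3)
    (fun x : E3 => ∑ i, 2 * x i * η (‖x‖ ^ 2 / ρ ^ 2) * pd i v x) ρ
  rw [key, smul_zero] at hscale
  have : (fun y : E3 => η (‖y‖ ^ 2) * fderiv ℝ v (ρ • y) y) = fun y => (1 / (2 * ρ)) *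
      ∑ i, 2 * (ρ • y) i * η (‖ρ • y‖ ^ 2 / ρ ^ 2) * pd i v (ρ • y) := by
    funext y
    rw [fderiv_eq_sum_pd, Finset.mul_sum, Finset.mul_sum]
    refine Finset.sum_congr rfl fun i _ => ?_
    have hn : ‖ρ • y‖ ^ 2 / ρ ^ 2 = ‖y‖ ^ 2 := by
      rw [norm_smul, mul_pow, Real.norm_eq_abs, sq_abs]
      field_simp
    rw [hn]
    simp only [PiLp.smul_apply, smul_eq_mul]
    field_simp
  rw [this, integral_const_mul, hscale, mul_zero]

/-- Differentiation under the integral sign. Since the weight vanishes outside radius `√c < 1`, the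
dilation factor may slightly exceed `1` without leaving the ball, which gives a two-sided derivative
even at `ρ = 1`. -/
lemma hasDerivAt_integral_radial_smul {v : E3 → ℝ} (hv : ContDiffOn ℝ 1 v B)
    {η : ℝ → ℝ} {c : ℝ} (hη : ContDiff ℝ ∞ η) (hc0 : 0 ≤ c) (hc1 : c < 1)
    (h0 : ∀ s, c ≤ s → η s = 0) {ρ : ℝ} (hρ : |ρ| ≤ 1) :
    HasDerivAt (fun ρ : ℝ => ∫ y, η (‖y‖ ^ 2) * v (ρ • y))
      (∫ y, η (‖y‖ ^ 2) * fderiv ℝ v (ρ • y) y) ρ := by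
  have hb1 : √c < 1 := by
    rw [Real.sqrt_lt' one_pos]
    simpa using hc1
  have hb0 := Real.sqrt_nonneg c
  -- Any `R` with `1 < R < 1 / √c` would do; this one also covers `c = 0`.
  set R : ℝ := 2 / (1 + √c) with hR
  have hR1 : 1 < R := by
    rw [hR, lt_div_iff₀ (by positivity)]
    linarith
  have hRb : R * √c < 1 := by
    rw [hR, div_mul_eq_mul_div, div_lt_one (by positivity)]
    linarith
  have hmaps : ∀ t : ℝ, |t| < R → ∀ y ∈ Metric.closedBall (0 : E3) (√c),
      t • y ∈ Metric.closedBall (0 : E3) (R * √c) := by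
    intro t ht y hy
    rw [mem_closedBall_zero_iff] at hy ⊢
    rw [norm_smul, Real.norm_eq_abs]
    exact mul_le_mul ht.le hy (norm_nonneg _) (by linarith)
  have hsubB : Metric.closedBall (0 : E3) (R * √c) ⊆ B := Metric.closedBall_subset_ball hRb
  obtain ⟨C, hC⟩ := (isCompact_closedBall (0 : E3) (R * √c)).exists_bound_of_continuousOn
    ((hv.continuousOn_fderiv_of_isOpen isOpen_B le_rfl).mono hsubB)
  have hηc : Continuous (fun y : E3 => η (‖y‖ ^ 2)) := (contDiff_radial hη).continuous
  have hout : ∀ y : E3, y ∉ Metric.closedBall (0 : E3) (√c) → η (‖y‖ ^ 2) = 0 := by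
    intro y hy
    apply h0
    have h1 : √c < ‖y‖ := by simpa using hy
    have := Real.sq_sqrt hc0
    nlinarith
  have hcont : ∀ t : ℝ, |t| < R → ∀ k : E3 → ℝ, (∀ y ∈ Metric.closedBall (0 : E3) (√c),
      ContinuousAt k y) → Integrable (fun y => η (‖y‖ ^ 2) * k y) := by
    intro t ht k hk
    have hc' : Continuous (fun y => η (‖y‖ ^ 2) * k y) := by
      refine continuous_of_tsupport fun y hy => ?_
      exact hηc.continuousAt.mul (hk y (tsupport_radial_subset hc0 h0 k hy))
    exact hc'.integrable_of_hasCompactSupport (hasCompactSupport_radial hc0 h0 k)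
  have hInt : ∀ t : ℝ, |t| < R → Integrable (fun y : E3 => η (‖y‖ ^ 2) * v (t • y)) := by
    intro t ht
    refine hcont t ht _ fun y hy => ?_
    have hmem := hsubB (hmaps t ht y hy)
    exact ContinuousAt.comp (g := v) (f := fun y : E3 => t • y)
      (hv.continuousOn.continuousAt (isOpen_B.mem_nhds hmem))
      (continuous_const_smul t).continuousAt
  have hInt' : ∀ t : ℝ, |t| < R →
      Integrable (fun y : E3 => η (‖y‖ ^ 2) * fderiv ℝ v (t • y) y) := by
    intro t ht
    refine hcont t ht _ fun y hy => ?_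
    have hmem := hsubB (hmaps t ht y hy)
    refine ContinuousAt.clm_apply ?_ continuousAt_id
    exact ContinuousAt.comp (g := fderiv ℝ v) (f := fun y : E3 => t • y)
      ((hv.continuousOn_fderiv_of_isOpen isOpen_B le_rfl).continuousAt (isOpen_B.mem_nhds hmem))
      (continuous_const_smul t).continuousAt
  have hρR : |ρ| < R := by linarith
  have hρmem : Metric.ball (0 : ℝ) R ∈ nhds ρ := Metric.isOpen_ball.mem_nhds (by simpa using hρR)
  refine (hasDerivAt_integral_of_dominated_loc_of_deriv_le (𝕜 := ℝ)
    (F := fun t y => η (‖y‖ ^ 2) * v (t • y))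
    (F' := fun t y => η (‖y‖ ^ 2) * fderiv ℝ v (t • y) y)
    (bound := fun y : E3 => |η (‖y‖ ^ 2) * (C * ‖y‖)|) (s := Metric.ball 0 R)
    hρmem ?_ (hInt ρ hρR)
    (hInt' ρ hρR).aestronglyMeasurable ?_ ?_ ?_).2
  · filter_upwards [hρmem] with t ht
    exact (hInt t (by simpa using ht)).aestronglyMeasurable
  · refine Filter.Eventually.of_forall fun y t ht => ?_
    have ht' : |t| < R := by simpa using ht
    by_cases hy : y ∈ Metric.closedBall (0 : E3) (√c)
    · rw [norm_mul, abs_mul, Real.norm_eq_abs]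
      refine mul_le_mul_of_nonneg_left ?_ (abs_nonneg _)
      refine ((fderiv ℝ v (t • y)).le_opNorm y).trans (le_trans ?_ (le_abs_self _))
      exact mul_le_mul_of_nonneg_right (hC _ (hmaps t ht' y hy)) (norm_nonneg _)
    · simp [hout y hy]
  · exact (hcont ρ hρR _ fun y _ => by fun_prop).abs
  · refine Filter.Eventually.of_forall fun y t ht => ?_
    have ht' : |t| < R := by simpa using ht
    by_cases hy : y ∈ Metric.closedBall (0 : E3) (√c)
    · have hmem := hsubB (hmaps t ht' y hy)
      have h1 := (differentiableAt_of_mem_B hv hmem).hasFDerivAt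
      have h2 : HasDerivAt (fun t : ℝ => t • y) y t := by
        simpa using (hasDerivAt_id t).smul_const y
      exact (h1.comp_hasDerivAt t h2).const_mul _
    · simpa [hout y hy] using hasDerivAt_const t (0 : ℝ)

/-- Weighted mean value property with a smooth radial weight. -/
lemma integral_radial_mul {v : E3 → ℝ} (hv : ContDiffOn ℝ 1 v B) (hw : WeaklyHarmonic v)
    {η : ℝ → ℝ} {c : ℝ} (hη : ContDiff ℝ ∞ η) (hc0 : 0 ≤ c) (hc1 : c < 1)
    (h0 : ∀ s, c ≤ s → η s = 0) :
    ∫ y, η (‖y‖ ^ 2) * v y = ∫ y : E3, η (‖y‖ ^ 2) * v 0 := by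
  set J : ℝ → ℝ := fun ρ => ∫ y, η (‖y‖ ^ 2) * v (ρ • y) with hJ
  have hd : ∀ ρ : ℝ, |ρ| ≤ 1 → HasDerivAt J (∫ y, η (‖y‖ ^ 2) * fderiv ℝ v (ρ • y) y) ρ :=
    fun ρ hρ => hasDerivAt_integral_radial_smul hv hη hc0 hc1 h0 hρ
  -- `J 1` is the weighted integral of `v` and `J 0` that of the constant `v 0`. The derivative
  -- vanishes on the open interval, so one application of the mean value theorem equates them.
  obtain ⟨ρ, hρ, hslope⟩ := exists_hasDerivAt_eq_slope J
    (fun ρ => ∫ y, η (‖y‖ ^ 2) * fderiv ℝ v (ρ • y) y) (zero_lt_one)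
    (fun ρ hρ => (hd ρ (by rw [abs_of_nonneg hρ.1]; exact hρ.2)).continuousAt.continuousWithinAt)
    (fun ρ hρ => hd ρ (by rw [abs_of_nonneg hρ.1.le]; exact hρ.2.le))
  rw [integral_radial_mul_fderiv_smul hw hη hc0 hc1 h0 hρ.1 hρ.2.le] at hslope
  have : J 1 = J 0 := by linarith [hslope]
  simpa [hJ] using this

lemma measureReal_B_pos : 0 < volume.real B :=
  ENNReal.toReal_pos (Metric.measure_ball_pos _ _ one_pos).ne' measure_ball_lt_top.ne

lemma integrableOn_B_of_continuous {k : E3 → ℝ} (hk : Continuous k) : IntegrableOn k B :=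
  (hk.continuousOn.integrableOn_compact (isCompact_closedBall (0 : E3) 1)).mono_set
    Metric.ball_subset_closedBall

/-- Mean value property over the unit ball, with the weight `p(‖x‖²)`. -/
lemma setIntegral_weight_mul {v : E3 → ℝ} (hv : ContDiffOn ℝ 1 v B) (hw : WeaklyHarmonic v)
    (hi : IntegrableOn v B) {p : ℝ → ℝ} (hp : ContDiff ℝ ∞ p) :
    ∫ x in B, p (‖x‖ ^ 2) * v x = v 0 * ∫ x in B, p (‖x‖ ^ 2) := by
  have hpc : Continuous (fun x : E3 => p (‖x‖ ^ 2)) := (contDiff_radial hp).continuous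
  obtain ⟨C, hC⟩ := (isCompact_closedBall (0 : E3) 1).exists_bound_of_continuousOn
    hpc.continuousOn
  have hi1 : IntegrableOn (fun x => p (‖x‖ ^ 2) * v x) B := by
    refine hi.bdd_mul hpc.aestronglyMeasurable ?_ (c := C)
    filter_upwards [ae_restrict_mem isOpen_B.measurableSet] with x hx
    exact hC x (Metric.ball_subset_closedBall hx)
  have hi2 : IntegrableOn (fun x : E3 => p (‖x‖ ^ 2) * v 0) B :=
    integrableOn_B_of_continuous (hpc.mul continuous_const)
  -- Stated for the difference because then every truncated integral vanishes exactly, and no limit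
  -- of the cutoff masses has to be computed.
  have key : ∫ x in B, (p (‖x‖ ^ 2) * v x - p (‖x‖ ^ 2) * v 0) = 0 := by
    refine setIntegral_eq_zero_of_cutoff (hi1.sub hi2) fun j => ?_
    have hsm : ContDiff ℝ ∞ (fun s => cutoff j s * p s) := (contDiff_cutoff j).mul hp
    have hz : ∀ s, cutoffRadius j ≤ s → cutoff j s * p s = 0 := fun s hs => by
      rw [cutoff_eq_zero hs, zero_mul]
    have hmv := integral_radial_mul hv hw hsm (cutoffRadius_pos j).le (cutoffRadius_lt_one j) hz
    have hcs := hasCompactSupport_radial (cutoffRadius_pos j).le hz (fun _ => 1)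
    have hts := (tsupport_radial_subset (cutoffRadius_pos j).le hz (fun _ => 1)).trans
      (closedBall_sqrt_subset (cutoffRadius_lt_one j))
    simp only [mul_one] at hcs hts
    have hcont := (contDiff_radial hsm).continuous
    have e : (fun x : E3 => cutoff j (‖x‖ ^ 2) * (p (‖x‖ ^ 2) * v x - p (‖x‖ ^ 2) * v 0)) =
        fun x => cutoff j (‖x‖ ^ 2) * p (‖x‖ ^ 2) * v x
          - cutoff j (‖x‖ ^ 2) * p (‖x‖ ^ 2) * v 0 := by
      funext x
      ring
    rw [e, integral_sub (integrable_test_mul hcont hcs hts hv.continuousOn)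
      (integrable_test_mul hcont hcs hts continuousOn_const), hmv, sub_self]
  rw [integral_sub hi1 hi2, integral_mul_const] at key
  linarith

lemma setIntegral_mean_value {v : E3 → ℝ} (hv : ContDiffOn ℝ 1 v B) (hw : WeaklyHarmonic v)
    (hi : IntegrableOn v B) : ∫ x in B, v x = v 0 * volume.real B := by
  simpa using setIntegral_weight_mul hv hw hi (p := fun _ => 1) contDiff_const

/-- The second moment of the unit ball. -/
lemma setIntegral_normSq : ∫ x in B, ‖x‖ ^ 2 = 3 / 5 * volume.real B := by
  have h := integral_fun_norm_addHaar (volume : Measure E3)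
    ((Set.Iio (1 : ℝ)).indicator fun y => y ^ 2)
  have h1 : (fun x : E3 => (Set.Iio (1 : ℝ)).indicator (fun y => y ^ 2) ‖x‖) =
      B.indicator (fun x => ‖x‖ ^ 2) := by
    funext x
    simp only [Set.indicator, Set.mem_Iio, mem_B]
  rw [h1, integral_indicator isOpen_B.measurableSet] at h
  rw [h]
  have h2 : (fun y : ℝ => y ^ (Module.finrank ℝ E3 - 1) •
      (Set.Iio (1 : ℝ)).indicator (fun y => y ^ 2) y) =
      (Set.Iio (1 : ℝ)).indicator (fun y => y ^ 4) := by
    funext y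
    simp only [finrank_euclideanSpace, Fintype.card_fin, Set.indicator, smul_eq_mul]
    split_ifs <;> ring
  rw [h2, setIntegral_indicator measurableSet_Iio, Set.Ioi_inter_Iio,
    ← integral_Ioc_eq_integral_Ioo, ← intervalIntegral.integral_of_le zero_le_one, integral_pow]
  simp only [finrank_euclideanSpace, Fintype.card_fin, nsmul_eq_mul, smul_eq_mul, B]
  norm_num
  ring

/-! ### Harmonic vector fields -/

/-- Continuously differentiable vector fields on the unit ball that are both curl free and
divergence free. -/
structure IsHarmonicField (F : Fin 3 → E3 → ℝ) : Prop where
  contDiffOn : ∀ i, ContDiffOn ℝ 1 (F i) B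
  curl : ∀ x ∈ B, ∀ i j, pd i (F j) x = pd j (F i) x
  div : ∀ x ∈ B, ∑ i, pd i (F i) x = 0

lemma eq_zero_of_notMem_B {ψ : E3 → ℝ} (hs : tsupport ψ ⊆ B) {x : E3} (hx : x ∉ B) : ψ x = 0 :=
  image_eq_zero_of_notMem_tsupport fun h => hx (hs h)

lemma integral_test_congr {ψ K L : E3 → ℝ} (hs : tsupport ψ ⊆ B) (h : ∀ x ∈ B, K x = L x) :
    ∫ x, ψ x * K x = ∫ x, ψ x * L x := by
  refine integral_congr_ae (Filter.Eventually.of_forall fun x => ?_)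
  by_cases hx : x ∈ B
  · simp [h x hx]
  · simp [eq_zero_of_notMem_B hs hx]

namespace IsHarmonicField

variable {F : Fin 3 → E3 → ℝ}

/-- A divergence free field is orthogonal to gradients of test functions. -/
lemma integral_pd_mul (hF : IsHarmonicField F) {Φ : E3 → ℝ} (hΦ : ContDiff ℝ ∞ Φ)
    (hc : HasCompactSupport Φ) (hs : tsupport Φ ⊆ B) :
    ∑ i, ∫ x, pd i Φ x * F i x = 0 := by
  have h1 : ∀ i, ∫ x, pd i Φ x * F i x = -∫ x, Φ x * pd i (F i) x := fun i => by
    rw [integral_mul_pd (hΦ.of_le (by simp)) hc hs (hF.contDiffOn i) i, neg_neg]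
  simp only [h1, Finset.sum_neg_distrib, neg_eq_zero]
  rw [← integral_finsetSum _ fun i _ =>
    integrable_test_mul hΦ.continuous hc hs (continuousOn_pd (hF.contDiffOn i) i)]
  simp only [← Finset.mul_sum]
  rw [integral_test_congr hs hF.div]
  simp

/-- Swap `∂ᵢ F_k` for `∂_k Fᵢ` by the curl condition and move `∂_k` to the test function: what
remains is `F` against the gradient of the test function `∂_k Φ`, which is zero because `F` is
divergence free. The weak form avoids second derivatives of `F`, which is only `C¹`. -/
lemma weaklyHarmonic (hF : IsHarmonicField F) (k : Fin 3) : WeaklyHarmonic (F k) := by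
  intro Φ hΦ hc hs
  have hpdc : ∀ i, ContDiff ℝ ∞ (pd i Φ) := fun i => contDiff_pd hΦ (by simp) i
  have hpds : ∀ i, tsupport (pd i Φ) ⊆ B := fun i => (tsupport_pd_subset Φ i).trans hs
  have hpdh : ∀ i, HasCompactSupport (pd i Φ) := fun i => HasCompactSupport.pd hc i
  rw [integral_finsetSum _ fun i _ => integrable_test_mul (hpdc i).continuous (hpdh i) (hpds i)
    (continuousOn_pd (hF.contDiffOn k) i)]
  have h1 : ∀ i, ∫ x, pd i Φ x * pd i (F k) x = -∫ x, pd i (pd k Φ) x * F i x := by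
    intro i
    rw [integral_test_congr (hpds i) (fun x hx => hF.curl x hx i k),
      integral_mul_pd ((hpdc i).of_le (by simp)) (hpdh i) (hpds i) (hF.contDiffOn i) k]
    simp only [pd_comm hΦ k i]
  simp only [h1, Finset.sum_neg_distrib, neg_eq_zero]
  exact hF.integral_pd_mul (hpdc k) (hpdh k) (hpds k)

/-- A harmonic field on the ball is a gradient. -/
lemma exists_potential (hF : IsHarmonicField F) :
    ∃ H : E3 → ℝ, ContDiffOn ℝ 1 H B ∧ ∀ x ∈ B, ∀ i, pd i H x = F i x := by
  -- The one-form `∑ Fᵢ dxᵢ` is closed by the curl condition; the Poincaré lemma on the convex ball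
  -- makes it exact.
  set α : E3 → E3 →L[ℝ] ℝ := fun x => ∑ i, F i x • (EuclideanSpace.proj i : E3 →L[ℝ] ℝ) with hα
  have hαd : DifferentiableOn ℝ α B := by
    intro x hx
    refine DifferentiableAt.differentiableWithinAt ?_
    refine DifferentiableAt.fun_sum fun i _ => ?_
    exact (differentiableAt_of_mem_B (hF.contDiffOn i) hx).smul_const _
  have hαf : ∀ x ∈ B, ∀ y z, fderiv ℝ α x y z = ∑ i, ∑ j, y j * pd j (F i) x * z i := by
    intro x hx y z
    have : HasFDerivAt α (∑ i, (fderiv ℝ (F i) x).smulRight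
        (EuclideanSpace.proj i : E3 →L[ℝ] ℝ)) x :=
      HasFDerivAt.fun_sum fun i _ =>
        (differentiableAt_of_mem_B (hF.contDiffOn i) hx).hasFDerivAt.smul_const
          (EuclideanSpace.proj i : E3 →L[ℝ] ℝ)
    rw [this.fderiv]
    simp [fderiv_eq_sum_pd, Finset.sum_mul]
  obtain ⟨H, hH⟩ := (convex_ball (0 : E3) 1).exists_forall_hasFDerivAt_of_fderiv_symmetric
    Metric.isOpen_ball hαd (by
      intro x hx y z
      rw [hαf x hx, hαf x hx, Finset.sum_comm]
      refine Finset.sum_congr rfl fun i _ => Finset.sum_congr rfl fun j _ => ?_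
      rw [hF.curl x hx]
      ring)
  refine ⟨H, ?_, fun x hx i => ?_⟩
  · rw [show (1 : WithTop ℕ∞) = 0 + 1 from (zero_add 1).symm,
      contDiffOn_succ_iff_fderiv_of_isOpen isOpen_B]
    refine ⟨fun x hx => (hH x hx).differentiableAt.differentiableWithinAt, by simp, ?_⟩
    rw [contDiffOn_zero]
    exact hαd.continuousOn.congr fun x hx => (hH x hx).fderiv
  · unfold pd
    rw [(hH x hx).fderiv]
    simp [hα]

end IsHarmonicField

/-! ### Reducing the gradient pairing to the scalar component -/

lemma pd_radial_mul {η : ℝ → ℝ} {p : E3 → ℝ} {x : E3} (hη : DifferentiableAt ℝ η (‖x‖ ^ 2))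
    (hp : DifferentiableAt ℝ p x) (i : Fin 3) :
    pd i (fun y => η (‖y‖ ^ 2) * p y) x =
      2 * x i * (deriv η (‖x‖ ^ 2) * p x) + η (‖x‖ ^ 2) * pd i p x := by
  rw [pd_mul (u := fun y => η (‖y‖ ^ 2)) _ hp, pd_radial hη]
  · ring
  · exact hη.comp x (hasFDerivAt_normSq x).differentiableAt

lemma laplacian_radial_mul {A : ℝ → ℝ} (hA : ContDiff ℝ ∞ A) {p : E3 → ℝ} (hp : ContDiff ℝ ∞ p)
    (x : E3) :
    ∑ i, pd i (pd i fun y => A (‖y‖ ^ 2) * p y) x =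
      (4 * ‖x‖ ^ 2 * deriv (deriv A) (‖x‖ ^ 2) + 6 * deriv A (‖x‖ ^ 2)) * p x
        + 4 * deriv A (‖x‖ ^ 2) * ∑ i, x i * pd i p x
        + A (‖x‖ ^ 2) * ∑ i, pd i (pd i p) x := by
  have hAd : ContDiff ℝ ∞ (deriv A) := (contDiff_infty_iff_deriv.1 hA).2
  have d1 : Differentiable ℝ A := hA.differentiable (by simp)
  have d2 : Differentiable ℝ (deriv A) := hAd.differentiable (by simp)
  have dp : Differentiable ℝ p := hp.differentiable (by simp)
  have dpi : ∀ i, Differentiable ℝ (pd i p) := fun i =>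
    (contDiff_pd (m := ∞) hp (by simp) i).differentiable (by simp)
  have dn : Differentiable ℝ fun y : E3 => ‖y‖ ^ 2 := (contDiff_norm_sq ℝ).differentiable one_ne_zero
  have dr : Differentiable ℝ fun y : E3 => deriv A (‖y‖ ^ 2) := d2.comp dn
  have dr' : Differentiable ℝ fun y : E3 => A (‖y‖ ^ 2) := d1.comp dn
  have hi : ∀ i, pd i (pd i fun y => A (‖y‖ ^ 2) * p y) x =
      2 * (deriv A (‖x‖ ^ 2) * p x) + 2 * x i * (2 * x i * (deriv (deriv A) (‖x‖ ^ 2) * p x)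
        + deriv A (‖x‖ ^ 2) * pd i p x) + (2 * x i * (deriv A (‖x‖ ^ 2) * pd i p x)
        + A (‖x‖ ^ 2) * pd i (pd i p) x) := by
    intro i
    have e : (pd i fun y => A (‖y‖ ^ 2) * p y) = fun y =>
        2 * y i * (deriv A (‖y‖ ^ 2) * p y) + A (‖y‖ ^ 2) * pd i p y :=
      funext fun y => pd_radial_mul (d1 _) (dp y) i
    have dc : Differentiable ℝ fun y : E3 => y i := by fun_prop
    rw [e, pd_add (((dc.const_mul 2).fun_mul (dr.fun_mul dp)) x) ((dr'.fun_mul (dpi i)) x),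
      pd_radial_mul (d1 _) (dpi i x),
      pd_mul (u := fun y => 2 * y i) ((dc.const_mul 2) x) ((dr.fun_mul dp) x),
      pd_radial_mul (d2 _) (dp x), pd_const_mul (dc x), pd_coord]
    simp
  simp only [hi, Fin.sum_univ_three, normSq_eq x]
  ring

/-- Solid harmonics of degree `n + 1` satisfying the three-term relation of the zonal
direction `x₀`. -/
structure IsAxial (n : ℕ) (κ : ℝ) (G : E3 → ℝ) : Prop where
  contDiff : ContDiff ℝ ∞ G
  laplace : ∀ x, ∑ i, pd i (pd i G) x = 0
  euler : ∀ x, ∑ i, x i * pd i G x = (n + 1) * G x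
  recurrence : ∀ x, (2 * n + 1) * (x 0 * pd 0 G x) = κ * G x + ‖x‖ ^ 2 * pd 0 (pd 0 G) x

/-- Differentiate Euler's identity in direction `k`; the product rule produces one extra `∂_k G`,
which lowers the degree by one. -/
lemma euler_pd {G : E3 → ℝ} (hG : ContDiff ℝ ∞ G) {d : ℝ}
    (h : ∀ x, ∑ i, x i * pd i G x = d * G x) (k : Fin 3) (x : E3) :
    ∑ i, x i * pd i (pd k G) x = (d - 1) * pd k G x := by
  have dG : Differentiable ℝ G := hG.differentiable (by simp)
  have dpi : ∀ i, Differentiable ℝ (pd i G) := fun i =>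
    (contDiff_pd (m := ∞) hG (by simp) i).differentiable (by simp)
  have dc : ∀ i, Differentiable ℝ fun y : E3 => y i := fun i => by fun_prop
  have h1 : pd k (fun y => ∑ i, y i * pd i G y) x = d * pd k G x := by
    rw [show (fun y => ∑ i, y i * pd i G y) = fun y => d * G y from funext h,
      pd_const_mul (dG x)]
  simp only [Fin.sum_univ_three] at h1 ⊢
  rw [pd_add ((((dc 0).fun_mul (dpi 0)).fun_add ((dc 1).fun_mul (dpi 1))) x)
      (((dc 2).fun_mul (dpi 2)) x),
    pd_add (((dc 0).fun_mul (dpi 0)) x) (((dc 1).fun_mul (dpi 1)) x),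
    pd_mul (dc 0 x) (dpi 0 x), pd_mul (dc 1 x) (dpi 1 x), pd_mul (dc 2 x) (dpi 2 x),
    pd_coord, pd_coord, pd_coord, pd_comm hG k 0, pd_comm hG k 1, pd_comm hG k 2] at h1
  fin_cases k <;> simp at h1 ⊢ <;> linarith

lemma laplace_pd {G : E3 → ℝ} (hG : ContDiff ℝ ∞ G) (h : ∀ x, ∑ i, pd i (pd i G) x = 0)
    (k : Fin 3) (x : E3) : ∑ i, pd i (pd i (pd k G)) x = 0 := by
  have hp : ∀ i, ContDiff ℝ ∞ (pd i G) := fun i => contDiff_pd hG (by simp) i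
  have dpi : ∀ i, Differentiable ℝ (pd i (pd i G)) := fun i =>
    (contDiff_pd (m := ∞) (hp i) (by simp) i).differentiable (by simp)
  have h1 : pd k (fun y => ∑ i, pd i (pd i G) y) x = 0 := by
    rw [show (fun y => ∑ i, pd i (pd i G) y) = fun _ => 0 from funext h, pd_const]
  simp only [Fin.sum_univ_three] at h1 ⊢
  rw [pd_add (((dpi 0).fun_add (dpi 1)) x) (dpi 2 x), pd_add (dpi 0 x) (dpi 1 x)] at h1
  have hc : ∀ i, pd i (pd i (pd k G)) x = pd k (pd i (pd i G)) x := by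
    intro i
    rw [show pd i (pd k G) = pd k (pd i G) from funext fun y => pd_comm hG i k y,
      pd_comm (hp i)]
  rw [hc, hc, hc, h1]

/-- Write `F = ∇H` and move all derivatives off `H`. The integrand becomes `H` times a combination
of divergences which is not zero, but is a multiple of the Laplacian of the test function `χ =
A(|x|²) ∂₀²G`, where `A' = w`. Since `H` is weakly harmonic, that Laplacian integrates to zero
against `H`. Truncating by `w` disposes of boundary terms, about which nothing is known. -/
lemma IsAxial.integral_cutoff {n : ℕ} {κ : ℝ} {G : E3 → ℝ} (hG : IsAxial n κ G)
    {F : Fin 3 → E3 → ℝ} (hF : IsHarmonicField F) (j : ℕ) :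
    ∫ x, cutoff j (‖x‖ ^ 2) *
      (κ * ∑ i, pd i G x * F i x - (2 * n + 1) * (n + 1) * (pd 0 G x * F 0 x)) = 0 := by
  obtain ⟨H, hH, hHF⟩ := hF.exists_potential
  set w := cutoff j
  set c := cutoffRadius j
  have hw : ContDiff ℝ ∞ w := contDiff_cutoff j
  have hw0 : ∀ s, c ≤ s → w s = 0 := fun s => cutoff_eq_zero
  have hc0 : 0 ≤ c := (cutoffRadius_pos j).le
  have hcB := closedBall_sqrt_subset (cutoffRadius_lt_one j)
  obtain ⟨A, hA, hAd, hA0⟩ := exists_antideriv hw hw0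
  have hAd' : deriv A = w := funext hAd
  have hp : ∀ i, ContDiff ℝ ∞ (pd i G) := fun i => contDiff_pd hG.contDiff (by simp) i
  set h := pd 0 (pd 0 G) with hh
  have hhs : ContDiff ℝ ∞ h := contDiff_pd (hp 0) (by simp) 0
  have sm : ∀ {η : ℝ → ℝ} {p : E3 → ℝ}, ContDiff ℝ ∞ η → ContDiff ℝ ∞ p →
      ContDiff ℝ ∞ fun x => η (‖x‖ ^ 2) * p x := fun hη hp => (contDiff_radial hη).mul hp
  have ts : ∀ {η : ℝ → ℝ} (p : E3 → ℝ), (∀ s, c ≤ s → η s = 0) →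
      tsupport (fun x => η (‖x‖ ^ 2) * p x) ⊆ B := fun p hη =>
    (tsupport_radial_subset hc0 hη p).trans hcB
  have cs : ∀ {η : ℝ → ℝ} (p : E3 → ℝ), (∀ s, c ≤ s → η s = 0) →
      HasCompactSupport (fun x => η (‖x‖ ^ 2) * p x) := fun p hη =>
    hasCompactSupport_radial hc0 hη p
  have hpot : ∀ {ψ : E3 → ℝ}, ContDiff ℝ ∞ ψ → HasCompactSupport ψ → tsupport ψ ⊆ B → ∀ i,
      ∫ x, ψ x * F i x = -∫ x, pd i ψ x * H x := by
    intro ψ h1 h2 h3 i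
    rw [← integral_mul_pd (h1.of_le (by simp)) h2 h3 hH i]
    exact integral_test_congr h3 fun x hx => (hHF x hx i).symm
  have ipd : ∀ {ψ : E3 → ℝ}, ContDiff ℝ ∞ ψ → HasCompactSupport ψ → tsupport ψ ⊆ B → ∀ i,
      Integrable fun x => pd i ψ x * H x := by
    intro ψ h1 h2 h3 i
    exact integrable_test_mul (contDiff_pd (m := 0) h1 (by simp) i).continuous
      (HasCompactSupport.pd h2 i) ((tsupport_pd_subset ψ i).trans h3) hH.continuousOn
  set ψ : Fin 3 → E3 → ℝ := fun i x => w (‖x‖ ^ 2) * pd i G x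
  set χ : E3 → ℝ := fun x => A (‖x‖ ^ 2) * h x
  have hψ : ∀ i, ContDiff ℝ ∞ (ψ i) ∧ HasCompactSupport (ψ i) ∧ tsupport (ψ i) ⊆ B :=
    fun i => ⟨sm hw (hp i), cs _ hw0, ts _ hw0⟩
  have hχ : ContDiff ℝ ∞ χ := sm hA hhs
  have hχc : HasCompactSupport χ := cs _ hA0
  have hχs : tsupport χ ⊆ B := ts _ hA0
  have hχi : ∀ i, ContDiff ℝ ∞ (pd i χ) := fun i => contDiff_pd hχ (by simp) i
  have hχci : ∀ i, HasCompactSupport (pd i χ) := fun i => HasCompactSupport.pd hχc i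
  have hχsi : ∀ i, tsupport (pd i χ) ⊆ B := fun i => (tsupport_pd_subset χ i).trans hχs
  have e1 : ∑ i, ∫ x, pd i χ x * F i x = 0 := hF.integral_pd_mul hχ hχc hχs
  simp only [fun i => hpot (hχi i) (hχci i) (hχsi i) i] at e1
  have split : ∫ x, w (‖x‖ ^ 2) *
      (κ * ∑ i, pd i G x * F i x - (2 * n + 1) * (n + 1) * (pd 0 G x * F 0 x)) =
      κ * (∑ i, ∫ x, ψ i x * F i x) - (2 * n + 1) * (n + 1) * ∫ x, ψ 0 x * F 0 x := by
    have hInt : ∀ i, Integrable fun x => ψ i x * F i x := fun i =>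
      integrable_test_mul (hψ i).1.continuous (hψ i).2.1 (hψ i).2.2 (hF.contDiffOn i).continuousOn
    rw [← integral_finsetSum _ fun i _ => hInt i, ← integral_const_mul, ← integral_const_mul,
      ← integral_sub ((integrable_finsetSum _ fun i _ => hInt i).const_mul κ)
        ((hInt 0).const_mul _)]
    congr 1
    funext x
    simp only [ψ, Fin.sum_univ_three]
    ring
  rw [split]
  simp only [fun i => hpot (hψ i).1 (hψ i).2.1 (hψ i).2.2 i]
  -- As `∂₀²G` is harmonic of degree `n - 1`, the Laplacian of `χ` is `(4|x|² w' + (4n+2) w) ∂₀²G`.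
  -- The factor `(n+1)/2` makes the terms with `w` cancel; the terms with `w'` form `2(n+1) w'`
  -- times the three-term relation.
  have hpoint : ∀ x, κ * (∑ i, pd i (ψ i) x) - (2 * n + 1) * (n + 1) * pd 0 (ψ 0) x
      + (n + 1) / 2 * ∑ i, pd i (pd i χ) x = 0 := by
    intro x
    have hpdψ : ∀ i, pd i (ψ i) x =
        2 * x i * (deriv w (‖x‖ ^ 2) * pd i G x) + w (‖x‖ ^ 2) * pd i (pd i G) x := fun i =>
      pd_radial_mul ((hw.differentiable (by simp)) _) (((hp i).differentiable (by simp)) x) i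
    have hE : ∑ i, x i * pd i h x = ((n : ℝ) + 1 - 1 - 1) * h x :=
      euler_pd (hp 0) (fun y => euler_pd hG.contDiff hG.euler 0 y) 0 x
    have hL : ∑ i, pd i (pd i h) x = 0 :=
      laplace_pd (hp 0) (fun y => laplace_pd hG.contDiff hG.laplace 0 y) 0 x
    have hlap := laplacian_radial_mul hA hhs x
    rw [hE, hL, hAd'] at hlap
    rw [show ∑ i, pd i (pd i χ) x = _ from hlap]
    have h1 := hG.laplace x
    have h2 := hG.euler x
    have h3 := hG.recurrence x
    simp only [hpdψ]
    simp only [Fin.sum_univ_three] at h1 h2 ⊢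
    rw [← hh] at h1 h3 ⊢
    linear_combination (κ * w (‖x‖ ^ 2)) * h1 + (2 * κ * deriv w (‖x‖ ^ 2)) * h2
      - 2 * (n + 1) * deriv w (‖x‖ ^ 2) * h3
  have hsum : κ * (∑ i, ∫ x, pd i (ψ i) x * H x)
      - (2 * n + 1) * (n + 1) * (∫ x, pd 0 (ψ 0) x * H x)
      + (n + 1) / 2 * ∑ i, ∫ x, pd i (pd i χ) x * H x = 0 := by
    have i1 : ∀ i, Integrable fun x => pd i (ψ i) x * H x := fun i =>
      ipd (hψ i).1 (hψ i).2.1 (hψ i).2.2 i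
    have i2 : ∀ i, Integrable fun x => pd i (pd i χ) x * H x := fun i =>
      ipd (hχi i) (hχci i) (hχsi i) i
    have i3 : Integrable fun x => κ * ∑ i, pd i (ψ i) x * H x
        - (2 * n + 1) * (n + 1) * (pd 0 (ψ 0) x * H x) :=
      ((integrable_finsetSum _ fun i _ => i1 i).const_mul κ).sub ((i1 0).const_mul _)
    rw [← integral_finsetSum _ fun i _ => i1 i, ← integral_finsetSum _ fun i _ => i2 i,
      ← integral_const_mul, ← integral_const_mul, ← integral_const_mul,
      ← integral_sub ((integrable_finsetSum _ fun i _ => i1 i).const_mul κ)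
        ((i1 0).const_mul _), ← integral_add i3
        ((integrable_finsetSum _ fun i _ => i2 i).const_mul _)]
    rw [← integral_zero E3 ℝ]
    congr 1
    funext x
    have := hpoint x
    simp only [Fin.sum_univ_three] at this ⊢
    linear_combination H x * this
  simp only [Finset.sum_neg_distrib, neg_eq_zero] at e1 ⊢
  rw [e1] at hsum
  linarith

/-- The gradient pairing of an axial solid harmonic with a harmonic field only sees the `x₀`
components. -/
lemma IsAxial.setIntegral_eq {n : ℕ} {κ : ℝ} {G : E3 → ℝ} (hG : IsAxial n κ G)
    {F : Fin 3 → E3 → ℝ} (hF : IsHarmonicField F) (hi : ∀ i, IntegrableOn (F i) B) :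
    κ * ∫ x in B, ∑ i, pd i G x * F i x =
      (2 * n + 1) * (n + 1) * ∫ x in B, pd 0 G x * F 0 x := by
  have hInt : ∀ i, IntegrableOn (fun x => pd i G x * F i x) B := by
    intro i
    have hc : Continuous (pd i G) := (contDiff_pd (m := 0) hG.contDiff (by simp) i).continuous
    obtain ⟨C, hC⟩ := (isCompact_closedBall (0 : E3) 1).exists_bound_of_continuousOn
      hc.continuousOn
    refine (hi i).bdd_mul hc.aestronglyMeasurable ?_ (c := C)
    filter_upwards [ae_restrict_mem isOpen_B.measurableSet] with x hx
    exact hC x (Metric.ball_subset_closedBall hx)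
  have i1 := (integrable_finsetSum Finset.univ fun i _ => hInt i).const_mul κ
  have i2 := (hInt 0).const_mul ((2 * (n : ℝ) + 1) * (n + 1))
  have := setIntegral_eq_zero_of_cutoff (i1.sub i2) fun j => hG.integral_cutoff hF j
  rw [integral_sub' i1 i2, integral_const_mul, integral_const_mul] at this
  linarith

/-! ### Recurrences for derivatives of Legendre polynomials -/

lemma iterate_derivative_succ_X_mul (p : ℝ[X]) (k : ℕ) :
    derivative^[k + 1] (X * p) =
      X * derivative^[k + 1] p + ((k : ℝ[X]) + 1) * derivative^[k] p := by
  induction k with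
  | zero => simp [add_comm]
  | succ k ih =>
    rw [Function.iterate_succ_apply' _ (k + 1), ih, Function.iterate_succ_apply' _ (k + 1),
      Function.iterate_succ_apply' _ k]
    simp only [derivative_add, derivative_mul, derivative_X, derivative_natCast, derivative_one]
    push_cast
    ring

lemma iterate_derivative_rodrigues_succ (n k : ℕ) :
    derivative^[k + 1] ((X ^ 2 - 1 : ℝ[X]) ^ (n + 1)) =
      2 * ((n : ℝ[X]) + 1) * derivative^[k] (X * (X ^ 2 - 1) ^ n) := by
  have h : derivative ((X ^ 2 - 1 : ℝ[X]) ^ (n + 1)) =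
      C (2 * ((n : ℝ) + 1)) * (X * (X ^ 2 - 1) ^ n) := by
    rw [derivative_pow]
    simp only [C_mul, C_add, C_1, map_natCast, map_ofNat, derivative_sub, derivative_X_pow,
      derivative_one]
    push_cast
    ring
  rw [Function.iterate_succ_apply, h, iterate_derivative_C_mul]
  simp only [C_mul, C_add, C_1, map_natCast, map_ofNat]

lemma legendre_const_succ (n : ℕ) :
    (C (1 / (2 ^ (n + 1) * ((n + 1).factorial : ℝ))) : ℝ[X]) * (2 * ((n : ℝ[X]) + 1)) =
      C (1 / (2 ^ n * (n.factorial : ℝ))) := by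
  have : (2 * ((n : ℝ[X]) + 1)) = C (2 * ((n : ℝ) + 1)) := by
    simp only [C_mul, C_add, C_1, map_natCast, map_ofNat]
  rw [this, ← C_mul]
  congr 1
  rw [Nat.factorial_succ]
  push_cast
  have : (n.factorial : ℝ) ≠ 0 := by exact_mod_cast n.factorial_ne_zero
  field_simp
  ring

lemma legendre_succ (n : ℕ) : legendre (n + 1) =
    C (1 / (2 ^ n * (n.factorial : ℝ))) * derivative^[n] (X * (X ^ 2 - 1) ^ n) := by
  rw [legendre, iterate_derivative_rodrigues_succ, ← mul_assoc, legendre_const_succ]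

lemma derivative_legendre (n : ℕ) : derivative (legendre n) =
    C (1 / (2 ^ n * (n.factorial : ℝ))) * derivative^[n + 1] ((X ^ 2 - 1) ^ n) := by
  rw [legendre, derivative_C_mul, Function.iterate_succ_apply']

lemma derivative_legendre_succ (n : ℕ) : derivative (legendre (n + 1)) =
    X * derivative (legendre n) + ((n : ℝ[X]) + 1) * legendre n := by
  rw [legendre_succ, derivative_C_mul, ← Function.iterate_succ_apply' derivative,
    iterate_derivative_succ_X_mul, derivative_legendre, legendre]
  ring

/-- Compute the `(n+1)`-st derivative of `(X² - 1)^(n+1)` in two ways: by first differentiating the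
power, and by splitting off one factor `X² - 1` and applying the Leibniz rule to the multiplications
by `X`. -/
lemma succ_mul_legendre_succ (n : ℕ) : ((n : ℝ[X]) + 1) * legendre (n + 1) =
    (X ^ 2 - 1) * derivative (legendre n) + ((n : ℝ[X]) + 1) * (X * legendre n) := by
  have h1 := iterate_derivative_rodrigues_succ n n
  have h2 : derivative^[n + 1] ((X ^ 2 - 1 : ℝ[X]) ^ (n + 1)) =
      X * (X * derivative^[n + 1] ((X ^ 2 - 1) ^ n)
        + ((n : ℝ[X]) + 1) * derivative^[n] ((X ^ 2 - 1) ^ n))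
        + ((n : ℝ[X]) + 1) * derivative^[n] (X * (X ^ 2 - 1) ^ n)
        - derivative^[n + 1] ((X ^ 2 - 1) ^ n) := by
    rw [show (X ^ 2 - 1 : ℝ[X]) ^ (n + 1) = X * (X * (X ^ 2 - 1) ^ n) - (X ^ 2 - 1) ^ n by ring,
      iterate_derivative_sub, iterate_derivative_succ_X_mul, iterate_derivative_succ_X_mul]
  rw [legendre_succ, derivative_legendre, legendre]
  linear_combination (C (1 / (2 ^ n * (n.factorial : ℝ)))) * (h2 - h1)

lemma X_mul_derivative_legendre_succ (n : ℕ) : X * derivative (legendre (n + 1)) =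
    ((n : ℝ[X]) + 1) * legendre (n + 1) + derivative (legendre n) := by
  linear_combination X * derivative_legendre_succ n - succ_mul_legendre_succ n

/-- The value at `t` of the `m`-th derivative of the Legendre polynomial `Pₙ`. -/
def legendreDeriv (n m : ℕ) (t : ℝ) : ℝ := (derivative^[m] (legendre n)).eval t

lemma hasDerivAt_legendreDeriv (n m : ℕ) (t : ℝ) :
    HasDerivAt (legendreDeriv n m) (legendreDeriv n (m + 1) t) t := by
  unfold legendreDeriv
  rw [Function.iterate_succ_apply']
  exact Polynomial.hasDerivAt _ _

lemma iterate_derivative_natCast_mul (k m : ℕ) (p : ℝ[X]) :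
    derivative^[m] (((k : ℝ[X]) + 1) * p) = ((k : ℝ[X]) + 1) * derivative^[m] p := by
  have : ((k : ℝ[X]) + 1) = C ((k : ℝ) + 1) := by simp
  rw [this, iterate_derivative_C_mul]

lemma iterate_derivative_X_mul_derivative (p : ℝ[X]) (m : ℕ) :
    derivative^[m] (X * derivative p) =
      X * derivative^[m + 1] p + (m : ℝ[X]) * derivative^[m] p := by
  cases m with
  | zero => simp
  | succ m =>
    rw [iterate_derivative_succ_X_mul, ← Function.iterate_succ_apply,
      ← Function.iterate_succ_apply]
    push_cast
    ring

lemma legendreDeriv_succ_succ (n m : ℕ) (t : ℝ) : legendreDeriv (n + 1) (m + 1) t =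
    t * legendreDeriv n (m + 1) t + (n + 1 + m) * legendreDeriv n m t := by
  have h : derivative^[m + 1] (legendre (n + 1)) = X * derivative^[m + 1] (legendre n)
      + ((n : ℝ[X]) + 1 + (m : ℝ[X])) * derivative^[m] (legendre n) := by
    rw [Function.iterate_succ_apply, derivative_legendre_succ, iterate_map_add,
      iterate_derivative_X_mul_derivative, iterate_derivative_natCast_mul]
    ring
  simp [legendreDeriv, h]

lemma mul_legendreDeriv_succ_succ (n m : ℕ) (t : ℝ) : t * legendreDeriv (n + 1) (m + 1) t =
    (n + 1 - m) * legendreDeriv (n + 1) m t + legendreDeriv n (m + 1) t := by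
  have h : X * derivative^[m + 1] (legendre (n + 1)) =
      ((n : ℝ[X]) + 1 - (m : ℝ[X])) * derivative^[m] (legendre (n + 1))
        + derivative^[m + 1] (legendre n) := by
    have h1 := congrArg derivative^[m] (X_mul_derivative_legendre_succ n)
    rw [iterate_map_add, iterate_derivative_X_mul_derivative,
      iterate_derivative_natCast_mul, ← Function.iterate_succ_apply] at h1
    linear_combination h1
  have h2 := congrArg (Polynomial.eval t) h
  simpa [legendreDeriv] using h2

lemma legendreDeriv_zero_zero (t : ℝ) : legendreDeriv 0 0 t = 1 := by
  simp [legendreDeriv, legendre]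

lemma legendreDeriv_zero_succ (m : ℕ) (t : ℝ) : legendreDeriv 0 (m + 1) t = 0 := by
  simp [legendreDeriv, legendre]

lemma legendreDeriv_eq_zero (n m : ℕ) (h : n < m) (t : ℝ) : legendreDeriv n m t = 0 := by
  induction n generalizing m with
  | zero =>
    obtain ⟨k, rfl⟩ := Nat.exists_eq_succ_of_ne_zero h.ne'
    exact legendreDeriv_zero_succ k t
  | succ n ih =>
    obtain ⟨k, rfl⟩ := Nat.exists_eq_succ_of_ne_zero (Nat.ne_zero_of_lt h)
    rw [legendreDeriv_succ_succ, ih _ (by lia), ih _ (by lia)]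
    ring

lemma legendreDeriv_self (n : ℕ) (t : ℝ) : legendreDeriv n n t = legendreDeriv n n 0 := by
  induction n with
  | zero => simp [legendreDeriv_zero_zero]
  | succ n ih =>
    rw [legendreDeriv_succ_succ, legendreDeriv_succ_succ,
      legendreDeriv_eq_zero n (n + 1) (by lia), legendreDeriv_eq_zero n (n + 1) (by lia), ih]
    ring

lemma legendreDeriv_succ_self (n : ℕ) (t : ℝ) :
    legendreDeriv (n + 1) n t = t * legendreDeriv (n + 1) (n + 1) 0 := by
  have := mul_legendreDeriv_succ_succ n n t
  rw [legendreDeriv_self (n + 1), legendreDeriv_eq_zero n (n + 1) (by lia)] at this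
  linarith

/-- Three-term recurrence in the degree. -/
lemma legendreDeriv_three_term (n m : ℕ) (t : ℝ) :
    (2 * n + 3) * (t * legendreDeriv (n + 1) m t) =
      (n + 2 - m) * legendreDeriv (n + 2) m t + (n + 1 + m) * legendreDeriv n m t := by
  have h1 := mul_legendreDeriv_succ_succ (n + 1) m t
  have h2 := legendreDeriv_succ_succ (n + 1) m t
  have h3 := mul_legendreDeriv_succ_succ n m t
  have h4 := legendreDeriv_succ_succ n m t
  push_cast at h1 h2
  linear_combination h1 - t * h2 - t * h3 + h4

/-- This and the next identity eliminate, from the two basic recurrences, the derivative of order `m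
+ 1` in degree `n` and in degree `n + 1` respectively. The first gives the `x₀`-derivative of zonal
functions, the second their Euler identity. -/
lemma legendreDeriv_lower (n m : ℕ) (t : ℝ) :
    (n + 1 - m) * (t * legendreDeriv (n + 1) m t) + (1 - t ^ 2) * legendreDeriv (n + 1) (m + 1) t =
      (n + 1 + m) * legendreDeriv n m t := by
  linear_combination legendreDeriv_succ_succ n m t - t * mul_legendreDeriv_succ_succ n m t

lemma legendreDeriv_raise (n m : ℕ) (t : ℝ) :
    (n + 1 - m) * legendreDeriv (n + 1) m t =
      (n + 1 + m) * (t * legendreDeriv n m t) - (1 - t ^ 2) * legendreDeriv n (m + 1) t := by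
  linear_combination t * legendreDeriv_succ_succ n m t - mul_legendreDeriv_succ_succ n m t

/-- The `m`-times differentiated Legendre equation, with its first-order term rewritten through
degree `n + 1`. In this form it serves both for harmonicity and for the `e₁`, `e₂` components of the
basis polynomials. -/
lemma legendreDeriv_order (n m : ℕ) (t : ℝ) :
    (1 - t ^ 2) * legendreDeriv n (m + 2) t - 2 * (m + 1) * legendreDeriv (n + 1) (m + 1) t
      + (n + m + 2) * (n + m + 1) * legendreDeriv n m t = 0 := by
  have h1 := legendreDeriv_succ_succ n (m + 1) t
  have h2 := mul_legendreDeriv_succ_succ n (m + 1) t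
  have h3 := legendreDeriv_succ_succ n m t
  push_cast at h1 h2
  linear_combination t * h1 - h2 - (n + m + 2) * h3

/-! ### Zonal factors of solid harmonics -/

/-- The polynomial `r ^ k * P_{m+k}^{(m)} (x₀ / r)`, by recursion on `k`. -/
def zonalAux (m : ℕ) : ℕ → E3 → ℝ
  | 0, _ => legendreDeriv m m 0
  | 1, x => x 0 * legendreDeriv (m + 1) (m + 1) 0
  | k + 2, x => ((2 * (m + k : ℝ) + 3) * (x 0 * zonalAux m (k + 1) x)
      - (2 * (m : ℝ) + k + 1) * (‖x‖ ^ 2 * zonalAux m k x)) / (k + 2)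

/-- The polynomial `r ^ (n - m) * Pₙ^{(m)} (x₀ / r)`. -/
def zonal (n m : ℕ) (x : E3) : ℝ := if m ≤ n then zonalAux m (n - m) x else 0

lemma contDiff_zonalAux (m k : ℕ) : ContDiff ℝ ∞ (zonalAux m k) := by
  have hn : ContDiff ℝ ∞ fun x : E3 => ‖x‖ ^ 2 := contDiff_norm_sq ℝ
  have h0 : ContDiff ℝ ∞ fun x : E3 => x 0 := by fun_prop
  induction k using Nat.twoStepInduction with
  | zero => exact contDiff_const
  | one => exact h0.mul contDiff_const
  | more k h1 h2 =>
    exact ((contDiff_const.mul (h0.mul h2)).sub (contDiff_const.mul (hn.mul h1))).div_const _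

lemma contDiff_zonal (n m : ℕ) : ContDiff ℝ ∞ (zonal n m) := by
  unfold zonal
  by_cases h : m ≤ n
  · simpa [h] using contDiff_zonalAux m (n - m)
  · simpa [h] using contDiff_const

/-- The recursion is the three-term recurrence multiplied by powers of `‖x‖`. Defining the function
through it makes smoothness at the origin evident; identities are then proved off the origin from
this formula and extended by continuity. -/
lemma zonalAux_eq (m k : ℕ) {x : E3} (hx : x ≠ 0) :
    zonalAux m k x = ‖x‖ ^ k * legendreDeriv (m + k) m (x 0 / ‖x‖) := by
  have hr : ‖x‖ ≠ 0 := norm_ne_zero_iff.2 hx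
  induction k using Nat.twoStepInduction with
  | zero => simp [zonalAux, legendreDeriv_self m (x 0 / ‖x‖)]
  | one =>
    rw [zonalAux, legendreDeriv_succ_self]
    field_simp
  | more k h1 h2 =>
    have h3 := legendreDeriv_three_term (m + k) m (x 0 / ‖x‖)
    rw [zonalAux, h1, h2, div_eq_iff (by positivity)]
    push_cast at h3
    rw [show m + (k + 1) = m + k + 1 by ring, show m + (k + 2) = m + k + 2 by ring]
    have h4 : (k + 2 : ℝ) * legendreDeriv (m + k + 2) m (x 0 / ‖x‖) =
        (2 * (m + k : ℝ) + 3) * (x 0 / ‖x‖ * legendreDeriv (m + k + 1) m (x 0 / ‖x‖))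
          - (2 * (m : ℝ) + k + 1) * legendreDeriv (m + k) m (x 0 / ‖x‖) := by
      linear_combination -h3
    have h5 : x 0 * ‖x‖ ^ (k + 1) = ‖x‖ ^ (k + 2) * (x 0 / ‖x‖) := by
      field_simp
      ring
    linear_combination (-‖x‖ ^ (k + 2)) * h4 + (2 * (m + k : ℝ) + 3) *
      legendreDeriv (m + k + 1) m (x 0 / ‖x‖) * h5

lemma zonal_eq (n m : ℕ) {x : E3} (hx : x ≠ 0) :
    zonal n m x = ‖x‖ ^ n / ‖x‖ ^ m * legendreDeriv n m (x 0 / ‖x‖) := by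
  have hr : ‖x‖ ≠ 0 := norm_ne_zero_iff.2 hx
  unfold zonal
  split_ifs with h
  · rw [zonalAux_eq m _ hx, Nat.add_sub_cancel' h, eq_div_of_mul_eq (pow_ne_zero m hr)
      (by rw [← pow_add, Nat.sub_add_cancel h] : ‖x‖ ^ (n - m) * ‖x‖ ^ m = ‖x‖ ^ n)]
  · rw [legendreDeriv_eq_zero n m (by lia), mul_zero]

/-- Continuous functions that agree off the origin agree everywhere. -/
lemma eq_of_eq_off_zero {u v : E3 → ℝ} (hu : Continuous u) (hv : Continuous v)
    (h : ∀ x, x ≠ 0 → u x = v x) : u = v :=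
  Continuous.ext_on (dense_compl_singleton (0 : E3)) hu hv fun x hx => h x hx

lemma pd_comp {φ : ℝ → ℝ} {u : E3 → ℝ} {φ' : ℝ} {x : E3} (hφ : HasDerivAt φ φ' (u x))
    (hu : DifferentiableAt ℝ u x) (i : Fin 3) : pd i (fun y => φ (u y)) x = φ' * pd i u x := by
  unfold pd
  have : HasFDerivAt (fun y => φ (u y)) _ x := hφ.comp_hasFDerivAt x hu.hasFDerivAt
  rw [this.fderiv]
  simp

lemma pd_norm {x : E3} (hx : x ≠ 0) (i : Fin 3) : pd i (fun y => ‖y‖) x = x i / ‖x‖ := by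
  have hr : ‖x‖ ≠ 0 := norm_ne_zero_iff.2 hx
  have h1 : pd i (fun y : E3 => ‖y‖ ^ 2) x = 2 * x i := by
    simpa using pd_radial (η := fun s => s) (x := x) differentiableAt_id i
  have h2 := pd_comp (φ := fun s => s ^ 2) (u := fun y : E3 => ‖y‖) (x := x)
    (by simpa using hasDerivAt_pow 2 ‖x‖)
    ((contDiffAt_norm ℝ hx).differentiableAt (n := 1) one_ne_zero) i
  rw [h1] at h2
  rw [eq_div_iff hr]
  linarith

lemma pd_congr {u v : E3 → ℝ} {x : E3} (h : u =ᶠ[nhds x] v) (i : Fin 3) : pd i u x = pd i v x := by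
  unfold pd
  rw [h.fderiv_eq]

lemma pd_zonal_of_ne (n m : ℕ) {x : E3} (hx : x ≠ 0) (i : Fin 3) :
    pd i (zonal n m) x = ‖x‖ ^ n / ‖x‖ ^ m / ‖x‖ *
      ((n - m) * (x i / ‖x‖) * legendreDeriv n m (x 0 / ‖x‖)
        + legendreDeriv n (m + 1) (x 0 / ‖x‖) *
          ((if i = 0 then 1 else 0) - x 0 / ‖x‖ * (x i / ‖x‖))) := by
  have hr : ‖x‖ ≠ 0 := norm_ne_zero_iff.2 hx
  have hev : zonal n m =ᶠ[nhds x] fun y =>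
      -- A quotient of powers instead of `s ^ (n - m)`, so that `m > n` needs no separate case and
      -- no truncated subtraction appears.
      (fun s : ℝ => s ^ n / s ^ m) ‖y‖ * legendreDeriv n m (y 0 * ‖y‖⁻¹) := by
    filter_upwards [isOpen_ne.mem_nhds hx] with y hy
    rw [zonal_eq n m hy, div_eq_mul_inv (y 0)]
  have dN : DifferentiableAt ℝ (fun y : E3 => ‖y‖) x :=
    (contDiffAt_norm ℝ hx).differentiableAt (n := 1) one_ne_zero
  have dc : DifferentiableAt ℝ (fun y : E3 => y 0) x := by fun_prop
  have dI : DifferentiableAt ℝ (fun y : E3 => ‖y‖⁻¹) x := dN.inv hr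
  have dT : DifferentiableAt ℝ (fun y : E3 => y 0 * ‖y‖⁻¹) x := dc.mul dI
  have hφ : HasDerivAt (fun s : ℝ => s ^ n / s ^ m)
      ((n - m) * (‖x‖ ^ n / ‖x‖ ^ m / ‖x‖)) ‖x‖ := by
    have := (hasDerivAt_pow n ‖x‖).div (hasDerivAt_pow m ‖x‖) (pow_ne_zero m hr)
    convert! this using 1
    have e : ∀ k : ℕ, (k : ℝ) * ‖x‖ ^ (k - 1) = k * (‖x‖ ^ k / ‖x‖) := by
      intro k
      cases k with
      | zero => simp
      | succ k => rw [Nat.add_sub_cancel, pow_succ]; field_simp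
    rw [e, e]
    field_simp
  have hT : pd i (fun y : E3 => y 0 * ‖y‖⁻¹) x =
      ((if i = 0 then 1 else 0) - x 0 / ‖x‖ * (x i / ‖x‖)) / ‖x‖ := by
    rw [pd_mul dc dI, pd_coord, pd_comp (hasDerivAt_inv hr) dN, pd_norm hx]
    field_simp
    ring
  rw [pd_congr hev, pd_mul, pd_comp hφ dN, pd_norm hx,
    pd_comp (hasDerivAt_legendreDeriv n m _) dT, hT]
  · rw [← div_eq_mul_inv (x 0)]
    field_simp
  · exact hφ.differentiableAt.comp x dN
  · exact (hasDerivAt_legendreDeriv n m _).differentiableAt.comp x dT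

lemma continuous_zonal (n m : ℕ) : Continuous (zonal n m) := (contDiff_zonal n m).continuous

lemma differentiable_zonal (n m : ℕ) : Differentiable ℝ (zonal n m) :=
  (contDiff_zonal n m).differentiable (by simp)

lemma continuous_pd_zonal (n m : ℕ) (i : Fin 3) : Continuous (pd i (zonal n m)) :=
  (contDiff_pd (m := 0) (contDiff_zonal n m) (by simp) i).continuous

lemma pd_zero_zonal (n m : ℕ) :
    pd 0 (zonal (n + 1) m) = fun x => (n + 1 + m) * zonal n m x := by
  refine eq_of_eq_off_zero (continuous_pd_zonal _ _ _)
    (continuous_const.mul (continuous_zonal _ _)) fun x hx => ?_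
  have hr : ‖x‖ ≠ 0 := norm_ne_zero_iff.2 hx
  have h := legendreDeriv_lower n m (x 0 / ‖x‖)
  have e : ‖x‖ ^ (n + 1) / ‖x‖ ^ m / ‖x‖ = ‖x‖ ^ n / ‖x‖ ^ m := by
    field_simp
    ring
  rw [pd_zonal_of_ne _ _ hx, zonal_eq _ _ hx, e]
  push_cast
  linear_combination (‖x‖ ^ n / ‖x‖ ^ m) * h

lemma pd_zonal_of_ne_zero (n m : ℕ) {i : Fin 3} (hi : i ≠ 0) :
    pd i (zonal (n + 1) m) = fun x => -(x i * zonal n (m + 1) x) := by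
  have hci : Continuous fun x : E3 => x i := by fun_prop
  refine eq_of_eq_off_zero (continuous_pd_zonal _ _ _)
    (hci.mul (continuous_zonal _ _)).neg fun x hx => ?_
  have hr : ‖x‖ ≠ 0 := norm_ne_zero_iff.2 hx
  have h := mul_legendreDeriv_succ_succ n m (x 0 / ‖x‖)
  have e : ‖x‖ ^ (n + 1) / ‖x‖ ^ m / ‖x‖ * (x i / ‖x‖) = x i * (‖x‖ ^ n / ‖x‖ ^ (m + 1)) := by
    field_simp
    ring
  rw [pd_zonal_of_ne _ _ hx, zonal_eq _ _ hx]
  push_cast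
  simp only [hi, if_false]
  linear_combination (-x i * (‖x‖ ^ n / ‖x‖ ^ (m + 1))) * h
    + ((n + 1 - m) * legendreDeriv (n + 1) m (x 0 / ‖x‖)
        - (x 0 / ‖x‖) * legendreDeriv (n + 1) (m + 1) (x 0 / ‖x‖)) * e

lemma zonal_three_term (n m : ℕ) (x : E3) :
    (2 * n + 3) * (x 0 * zonal (n + 1) m x) =
      (n + 2 - m) * zonal (n + 2) m x + (n + 1 + m) * (‖x‖ ^ 2 * zonal n m x) := by
  have c0 : Continuous fun x : E3 => x 0 := by fun_prop
  refine congrFun (eq_of_eq_off_zero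
    (u := fun x => (2 * n + 3) * (x 0 * zonal (n + 1) m x))
    (v := fun x => (n + 2 - m) * zonal (n + 2) m x + (n + 1 + m) * (‖x‖ ^ 2 * zonal n m x))
    (continuous_const.mul (c0.mul (continuous_zonal _ _)))
    ((continuous_const.mul (continuous_zonal _ _)).add
      (continuous_const.mul ((continuous_norm.pow 2).mul (continuous_zonal _ _))))
    fun x hx => ?_) x
  have hr : ‖x‖ ≠ 0 := norm_ne_zero_iff.2 hx
  have h := legendreDeriv_three_term n m (x 0 / ‖x‖)
  have e1 : x 0 * (‖x‖ ^ (n + 1) / ‖x‖ ^ m) = ‖x‖ ^ (n + 2) / ‖x‖ ^ m * (x 0 / ‖x‖) := by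
    field_simp
    ring
  simp only [zonal_eq _ _ hx]
  linear_combination (‖x‖ ^ (n + 2) / ‖x‖ ^ m) * h
    + (2 * n + 3) * legendreDeriv (n + 1) m (x 0 / ‖x‖) * e1

lemma sq_add_sq_eq {x : E3} (hx : x ≠ 0) :
    x 1 ^ 2 + x 2 ^ 2 = ‖x‖ ^ 2 * (1 - (x 0 / ‖x‖) ^ 2) := by
  have hr : ‖x‖ ≠ 0 := norm_ne_zero_iff.2 hx
  have := normSq_eq x
  field_simp
  linarith

lemma zonal_raise (n m : ℕ) (x : E3) :
    (n + 1 - m) * zonal (n + 1) m x =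
      (n + 1 + m) * (x 0 * zonal n m x) - (x 1 ^ 2 + x 2 ^ 2) * zonal n (m + 1) x := by
  have c : ∀ i, Continuous fun x : E3 => x i := fun i => by fun_prop
  refine congrFun (eq_of_eq_off_zero
    (u := fun x => (n + 1 - m) * zonal (n + 1) m x)
    (v := fun x => (n + 1 + m) * (x 0 * zonal n m x)
      - (x 1 ^ 2 + x 2 ^ 2) * zonal n (m + 1) x)
    (continuous_const.mul (continuous_zonal _ _))
    ((continuous_const.mul ((c 0).mul (continuous_zonal _ _))).sub
      ((((c 1).pow 2).add ((c 2).pow 2)).mul (continuous_zonal _ _)))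
    fun x hx => ?_) x
  have hr : ‖x‖ ≠ 0 := norm_ne_zero_iff.2 hx
  have h := legendreDeriv_raise n m (x 0 / ‖x‖)
  have e1 : x 0 * (‖x‖ ^ n / ‖x‖ ^ m) = ‖x‖ ^ (n + 1) / ‖x‖ ^ m * (x 0 / ‖x‖) := by
    field_simp
    ring
  have e2 : ‖x‖ ^ 2 * (‖x‖ ^ n / ‖x‖ ^ (m + 1)) = ‖x‖ ^ (n + 1) / ‖x‖ ^ m := by
    field_simp
    ring
  simp only [zonal_eq _ _ hx, sq_add_sq_eq hx]
  linear_combination (‖x‖ ^ (n + 1) / ‖x‖ ^ m) * h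
    - (n + 1 + m) * legendreDeriv n m (x 0 / ‖x‖) * e1
    + (1 - (x 0 / ‖x‖) ^ 2) * legendreDeriv n (m + 1) (x 0 / ‖x‖) * e2

lemma zonal_order (n m : ℕ) (x : E3) :
    (x 1 ^ 2 + x 2 ^ 2) * zonal n (m + 2) x - 2 * (m + 1) * zonal (n + 1) (m + 1) x
      + (n + m + 2) * (n + m + 1) * zonal n m x = 0 := by
  have c : ∀ i, Continuous fun x : E3 => x i := fun i => by fun_prop
  refine congrFun (eq_of_eq_off_zero
    (u := fun x => (x 1 ^ 2 + x 2 ^ 2) * zonal n (m + 2) x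
      - 2 * (m + 1) * zonal (n + 1) (m + 1) x + (n + m + 2) * (n + m + 1) * zonal n m x)
    (v := fun _ => 0)
    ((((((c 1).pow 2).add ((c 2).pow 2)).mul (continuous_zonal _ _)).sub
      (continuous_const.mul (continuous_zonal _ _))).add
      (continuous_const.mul (continuous_zonal _ _))) continuous_const
    fun x hx => ?_) x
  have hr : ‖x‖ ≠ 0 := norm_ne_zero_iff.2 hx
  have h := legendreDeriv_order n m (x 0 / ‖x‖)
  have e1 : ‖x‖ ^ (n + 1) / ‖x‖ ^ (m + 1) = ‖x‖ ^ n / ‖x‖ ^ m := by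
    field_simp
    ring
  have e2 : ‖x‖ ^ 2 * (‖x‖ ^ n / ‖x‖ ^ (m + 2)) = ‖x‖ ^ n / ‖x‖ ^ m := by
    field_simp
    ring
  simp only [zonal_eq _ _ hx, sq_add_sq_eq hx]
  linear_combination (‖x‖ ^ n / ‖x‖ ^ m) * h
    - 2 * (m + 1) * legendreDeriv (n + 1) (m + 1) (x 0 / ‖x‖) * e1
    + (1 - (x 0 / ‖x‖) ^ 2) * legendreDeriv n (m + 2) (x 0 / ‖x‖) * e2

/-! ### Planar harmonic polynomials -/

/-- The planar harmonic polynomial `Re (θ (x₁ + i x₂) ^ m)`. -/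
def planar (θ : ℂ) (m : ℕ) (x : E3) : ℝ := (θ * ((x 1 : ℂ) + x 2 * Complex.I) ^ m).re

lemma planar_zero (θ : ℂ) (x : E3) : planar θ 0 x = θ.re := by simp [planar]

/-- Keeping a complex phase `θ` treats cosine (`θ = 1`) and sine (`θ = -i`) together: multiplying by
`x₂ i` only rotates the phase, so inductions over `m` close when `θ` is generalized. -/
lemma planar_succ (θ : ℂ) (m : ℕ) (x : E3) :
    planar θ (m + 1) x = x 1 * planar θ m x + x 2 * planar (Complex.I * θ) m x := by
  unfold planar
  have e : θ * ((x 1 : ℂ) + x 2 * Complex.I) ^ (m + 1) =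
      (x 1 : ℂ) * (θ * ((x 1 : ℂ) + x 2 * Complex.I) ^ m)
        + (x 2 : ℂ) * (Complex.I * θ * ((x 1 : ℂ) + x 2 * Complex.I) ^ m) := by ring
  rw [e, Complex.add_re, Complex.re_ofReal_mul, Complex.re_ofReal_mul]

lemma planar_neg (θ : ℂ) (m : ℕ) (x : E3) : planar (-θ) m x = -planar θ m x := by
  simp [planar]

lemma I_mul_I_mul (θ : ℂ) : Complex.I * (Complex.I * θ) = -θ := by
  rw [← mul_assoc, Complex.I_mul_I, neg_one_mul]

lemma planar_I_succ (θ : ℂ) (m : ℕ) (x : E3) :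
    planar (Complex.I * θ) (m + 1) x = x 1 * planar (Complex.I * θ) m x - x 2 * planar θ m x := by
  rw [planar_succ, I_mul_I_mul, planar_neg]
  ring

lemma contDiff_planar (θ : ℂ) (m : ℕ) : ContDiff ℝ ∞ (planar θ m) := by
  have c : ∀ i, ContDiff ℝ ∞ fun x : E3 => x i := fun i => by fun_prop
  induction m generalizing θ with
  | zero =>
    rw [show planar θ 0 = fun _ => θ.re from funext (planar_zero θ)]
    exact contDiff_const
  | succ m ih =>
    rw [show planar θ (m + 1) = _ from funext (planar_succ θ m)]
    exact ((c 1).mul (ih θ)).add ((c 2).mul (ih _))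

lemma differentiable_planar (θ : ℂ) (m : ℕ) : Differentiable ℝ (planar θ m) :=
  (contDiff_planar θ m).differentiable (by simp)

lemma pd_planar_zero (θ : ℂ) (i : Fin 3) (x : E3) : pd i (planar θ 0) x = 0 := by
  rw [show planar θ 0 = fun _ => θ.re from funext (planar_zero θ), pd_const]

lemma pd_planar_step (θ : ℂ) (m : ℕ) (i : Fin 3) (x : E3) : pd i (planar θ (m + 1)) x =
    ((if i = 1 then 1 else 0) * planar θ m x + x 1 * pd i (planar θ m) x)
      + ((if i = 2 then 1 else 0) * planar (Complex.I * θ) m x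
        + x 2 * pd i (planar (Complex.I * θ) m) x) := by
  have c : ∀ i, Differentiable ℝ fun x : E3 => x i := fun i => by fun_prop
  have hd := fun θ => differentiable_planar θ m
  rw [show planar θ (m + 1) = _ from funext (planar_succ θ m),
    pd_add (((c 1).fun_mul (hd θ)) x) (((c 2).fun_mul (hd _)) x), pd_mul (c 1 x) (hd θ x),
    pd_mul (c 2 x) (hd _ x), pd_coord, pd_coord]

lemma pd_planar_succ (θ : ℂ) (m : ℕ) (x : E3) :
    pd 0 (planar θ (m + 1)) x = 0 ∧ pd 1 (planar θ (m + 1)) x = (m + 1) * planar θ m x ∧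
      pd 2 (planar θ (m + 1)) x = (m + 1) * planar (Complex.I * θ) m x := by
  induction m generalizing θ with
  | zero => simp [pd_planar_step, pd_planar_zero, planar_zero]
  | succ m ih =>
    obtain ⟨a0, a1, a2⟩ := ih θ
    obtain ⟨b0, b1, b2⟩ := ih (Complex.I * θ)
    rw [I_mul_I_mul, planar_neg] at b2
    rw [pd_planar_step θ (m + 1) 0, pd_planar_step θ (m + 1) 1, pd_planar_step θ (m + 1) 2,
      a0, a1, a2, b0, b1, b2]
    refine ⟨by simp, ?_, ?_⟩
    · rw [if_pos rfl, if_neg (by decide), planar_succ θ m]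
      push_cast
      ring
    · rw [if_pos rfl, if_neg (by decide), planar_I_succ θ m]
      push_cast
      ring

lemma pd_zero_planar (θ : ℂ) (m : ℕ) (x : E3) : pd 0 (planar θ m) x = 0 := by
  cases m with
  | zero => exact pd_planar_zero θ 0 x
  | succ m => exact (pd_planar_succ θ m x).1

lemma planar_euler (θ : ℂ) (m : ℕ) (x : E3) :
    x 1 * pd 1 (planar θ m) x + x 2 * pd 2 (planar θ m) x = m * planar θ m x := by
  cases m with
  | zero => simp [pd_planar_zero]
  | succ m =>
    obtain ⟨-, h1, h2⟩ := pd_planar_succ θ m x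
    rw [h1, h2, planar_succ]
    push_cast
    ring

lemma pd_one_add_pd_two_planar (θ : ℂ) (m : ℕ) (x : E3) :
    pd 1 (planar θ m) x + pd 2 (planar (Complex.I * θ) m) x = 0 := by
  cases m with
  | zero => simp [pd_planar_zero]
  | succ m =>
    rw [(pd_planar_succ θ m x).2.1, (pd_planar_succ _ m x).2.2, I_mul_I_mul, planar_neg]
    ring

lemma planar_laplace (θ : ℂ) (m : ℕ) (x : E3) : ∑ i, pd i (pd i (planar θ m)) x = 0 := by
  rw [Fin.sum_univ_three, show pd 0 (planar θ m) = fun _ => 0 from funext (pd_zero_planar θ m),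
    pd_const]
  cases m with
  | zero =>
    rw [show pd 1 (planar θ 0) = fun _ => 0 from funext (pd_planar_zero θ 1),
      show pd 2 (planar θ 0) = fun _ => 0 from funext (pd_planar_zero θ 2), pd_const, pd_const]
    simp
  | succ m =>
    rw [show pd 1 (planar θ (m + 1)) = _ from funext fun y => (pd_planar_succ θ m y).2.1,
      show pd 2 (planar θ (m + 1)) = _ from funext fun y => (pd_planar_succ θ m y).2.2,
      pd_const_mul (differentiable_planar _ _ x), pd_const_mul (differentiable_planar _ _ x)]
    linear_combination (m + 1 : ℝ) * pd_one_add_pd_two_planar θ m x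

lemma laplacian_mul {u v : E3 → ℝ} (hu : ContDiff ℝ ∞ u) (hv : ContDiff ℝ ∞ v) (x : E3) :
    ∑ i, pd i (pd i fun y => u y * v y) x = (∑ i, pd i (pd i u) x) * v x
      + 2 * (∑ i, pd i u x * pd i v x) + u x * ∑ i, pd i (pd i v) x := by
  have du : Differentiable ℝ u := hu.differentiable (by simp)
  have dv : Differentiable ℝ v := hv.differentiable (by simp)
  have dui : ∀ i, Differentiable ℝ (pd i u) := fun i =>
    (contDiff_pd (m := ∞) hu (by simp) i).differentiable (by simp)
  have dvi : ∀ i, Differentiable ℝ (pd i v) := fun i =>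
    (contDiff_pd (m := ∞) hv (by simp) i).differentiable (by simp)
  have h : ∀ i, pd i (pd i fun y => u y * v y) x =
      pd i (pd i u) x * v x + 2 * (pd i u x * pd i v x) + u x * pd i (pd i v) x := by
    intro i
    rw [show (pd i fun y => u y * v y) = _ from funext fun y => pd_mul (du y) (dv y) i,
      pd_add (((dui i).fun_mul dv) x) ((du.fun_mul (dvi i)) x), pd_mul (dui i x) (dv x),
      pd_mul (du x) (dvi i x)]
    ring
  simp only [h, Fin.sum_univ_three]
  ring

/-! ### Solid harmonics and their potentials -/

/-- The solid harmonic `r ^ n * Pₙᵐ (x₀ / r) * Re (θ e ^ {i m φ})`. -/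
def solid (θ : ℂ) (n m : ℕ) (x : E3) : ℝ := zonal n m x * planar θ m x

lemma contDiff_solid (θ : ℂ) (n m : ℕ) : ContDiff ℝ ∞ (solid θ n m) :=
  (contDiff_zonal n m).mul (contDiff_planar θ m)

lemma pd_zero_solid (θ : ℂ) (n m : ℕ) :
    pd 0 (solid θ (n + 1) m) = fun x => (n + 1 + m) * solid θ n m x := by
  funext x
  unfold solid
  rw [pd_mul (differentiable_zonal _ _ x) (differentiable_planar _ _ x), pd_zero_zonal,
    pd_zero_planar]
  ring

lemma pd_solid (θ : ℂ) (n m : ℕ) {i : Fin 3} (hi : i ≠ 0) (x : E3) :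
    pd i (solid θ (n + 1) m) x = -(x i * zonal n (m + 1) x) * planar θ m x
      + zonal (n + 1) m x * pd i (planar θ m) x := by
  unfold solid
  rw [pd_mul (differentiable_zonal _ _ x) (differentiable_planar _ _ x),
    pd_zonal_of_ne_zero n m hi]

/-- The planar factor is harmonic, so only the Laplacian of the zonal factor and the cross term
survive. The cross term is `-2m` times a zonal function by Euler's identity in the plane, and
`zonal_order` cancels the sum. -/
lemma solid_laplace (θ : ℂ) (n m : ℕ) (x : E3) :
    ∑ i, pd i (pd i (solid θ (n + 2) m)) x = 0 := by
  have hz := zonal_order n m x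
  have he := planar_euler θ m x
  have hq : ∀ i : Fin 3, i ≠ 0 → pd i (pd i (zonal (n + 2) m)) x =
      -zonal (n + 1) (m + 1) x + x i ^ 2 * zonal n (m + 2) x := by
    intro i hi
    have c : DifferentiableAt ℝ (fun x : E3 => x i) x := by fun_prop
    have dz := differentiable_zonal (n + 1) (m + 1) x
    rw [pd_zonal_of_ne_zero (n + 1) m hi,
      show (fun x : E3 => -(x i * zonal (n + 1) (m + 1) x)) =
        fun x => (-1) * (x i * zonal (n + 1) (m + 1) x) from funext fun _ => by ring,
      pd_const_mul (c.fun_mul dz), pd_mul c dz, pd_zonal_of_ne_zero n (m + 1) hi, pd_coord]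
    simp only [if_true]
    ring
  have hq0 : pd 0 (pd 0 (zonal (n + 2) m)) x = (n + 2 + m) * ((n + 1 + m) * zonal n m x) := by
    rw [pd_zero_zonal (n + 1) m, pd_const_mul (differentiable_zonal _ _ x), pd_zero_zonal]
    push_cast
    ring
  have := laplacian_mul (contDiff_zonal (n + 2) m) (contDiff_planar θ m) x
  rw [planar_laplace] at this
  rw [show ∑ i, pd i (pd i (solid θ (n + 2) m)) x = _ from this]
  simp only [Fin.sum_univ_three]
  rw [hq0, hq 1 (by decide), hq 2 (by decide), pd_zero_planar,
    congrFun (pd_zonal_of_ne_zero (n + 1) m (i := 1) (by decide)) x,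
    congrFun (pd_zonal_of_ne_zero (n + 1) m (i := 2) (by decide)) x]
  linear_combination planar θ m x * hz - 2 * zonal (n + 1) (m + 1) x * he

lemma solid_euler (θ : ℂ) (n m : ℕ) (x : E3) :
    ∑ i, x i * pd i (solid θ (n + 1) m) x = (n + 1) * solid θ (n + 1) m x := by
  have h1 := zonal_raise n m x
  have h2 := planar_euler θ m x
  rw [Fin.sum_univ_three, pd_zero_solid, pd_solid θ n m (i := 1) (by decide),
    pd_solid θ n m (i := 2) (by decide)]
  unfold solid
  linear_combination zonal (n + 1) m x * h2 - planar θ m x * h1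

/-- The potential whose conjugate gradient is the monogenic polynomial of degree `n`. -/
def potential (θ : ℂ) (n m : ℕ) (x : E3) : ℝ := 1 / 2 * solid θ (n + 1) m x

lemma contDiff_potential (θ : ℂ) (n m : ℕ) : ContDiff ℝ ∞ (potential θ n m) :=
  contDiff_const.mul (contDiff_solid θ (n + 1) m)

lemma pd_potential (θ : ℂ) (n m : ℕ) (i : Fin 3) :
    pd i (potential θ n m) = fun x => 1 / 2 * pd i (solid θ (n + 1) m) x :=
  funext fun x => pd_const_mul (((contDiff_solid θ (n + 1) m).differentiable (by simp)) x) _ i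

lemma pd_zero_potential (θ : ℂ) (n m : ℕ) (x : E3) :
    pd 0 (potential θ n m) x = (n + m + 1) / 2 * solid θ n m x := by
  rw [pd_potential, pd_zero_solid]
  ring

/-- `∂₀` lowers the degree and keeps the order, so the three-term recurrence in the degree becomes
the required relation between `G`, `∂₀G` and `∂₀²G`, with `κ = (n + 2 - m)(n + 2 + m)`. -/
lemma isAxial_potential (θ : ℂ) (n m : ℕ) :
    IsAxial (n + 1) (((n : ℝ) + 2) ^ 2 - (m : ℝ) ^ 2) (potential θ (n + 1) m) where
  contDiff := contDiff_potential θ (n + 1) m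
  laplace x := by
    have d : ∀ i, Differentiable ℝ (pd i (solid θ (n + 2) m)) := fun i =>
      (contDiff_pd (m := ∞) (contDiff_solid θ (n + 2) m) (by simp) i).differentiable (by simp)
    simp only [pd_potential, pd_const_mul (d _ x)]
    rw [← Finset.mul_sum, solid_laplace, mul_zero]
  euler x := by
    have := solid_euler θ (n + 1) m x
    simp only [pd_potential]
    simp only [Fin.sum_univ_three, potential] at this ⊢
    push_cast at this ⊢
    linear_combination 1 / 2 * this
  recurrence x := by
    have h := zonal_three_term n m x
    have hp : pd 0 (potential θ (n + 1) m) = fun x => ((n + 2 + m) / 2) * solid θ (n + 1) m x := by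
      funext y
      rw [pd_zero_potential]
      push_cast
      ring
    rw [hp, pd_const_mul (((contDiff_solid θ (n + 1) m).differentiable (by simp)) x),
      pd_zero_solid]
    unfold potential solid
    push_cast
    linear_combination ((n + 2 + m) / 2 * planar θ m x) * h

/-! ### The basis polynomials as conjugate gradients -/

/-- The quaternion-conjugate of the gradient of `G`. -/
def conjGrad (G : E3 → ℝ) (x : E3) : ℍ[ℝ] := ⟨pd 0 G x, -pd 1 G x, -pd 2 G x, 0⟩

lemma quaternion_smul_mk (c a b d e : ℝ) :
    c • (⟨a, b, d, e⟩ : ℍ[ℝ]) = ⟨c * a, c * b, c * d, c * e⟩ := rfl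

lemma sqrt_mul_cosPhi (x : E3) : √(x 1 ^ 2 + x 2 ^ 2) * cosPhi x = x 1 := by
  unfold cosPhi
  by_cases h : √(x 1 ^ 2 + x 2 ^ 2) = 0
  · rw [Real.sqrt_eq_zero (by positivity)] at h
    have : x 1 = 0 := by nlinarith [sq_nonneg (x 1), sq_nonneg (x 2)]
    simp [this]
  · field_simp

lemma sqrt_mul_sinPhi (x : E3) : √(x 1 ^ 2 + x 2 ^ 2) * sinPhi x = x 2 := by
  unfold sinPhi
  by_cases h : √(x 1 ^ 2 + x 2 ^ 2) = 0
  · rw [Real.sqrt_eq_zero (by positivity)] at h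
    have : x 2 = 0 := by nlinarith [sq_nonneg (x 1), sq_nonneg (x 2)]
    simp [this]
  · field_simp

/-- De Moivre's formula: real and imaginary parts of `(x₁ + i x₂)^m` in polar form. Both must be
proved in one induction since each step mixes them. -/
lemma planar_eq_chebyshev (m : ℕ) (x : E3) :
    √(x 1 ^ 2 + x 2 ^ 2) ^ m * chebT m (cosPhi x) = planar 1 m x ∧
      √(x 1 ^ 2 + x 2 ^ 2) ^ m * (sinPhi x * chebU (m - 1) (cosPhi x)) =
        planar (-Complex.I) m x := by
  set ρ := √(x 1 ^ 2 + x 2 ^ 2) with hρ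
  have hρ2 : ρ ^ 2 = x 1 ^ 2 + x 2 ^ 2 := Real.sq_sqrt (by positivity)
  have hc : ρ * cosPhi x = x 1 := sqrt_mul_cosPhi x
  have hs : ρ * sinPhi x = x 2 := sqrt_mul_sinPhi x
  induction m with
  | zero => simp [planar_zero, chebT, chebU]
  | succ m ih =>
    obtain ⟨ih1, ih2⟩ := ih
    have hI : planar Complex.I m x = -planar (-Complex.I) m x := by rw [planar_neg, neg_neg]
    rw [planar_succ, planar_succ, mul_one, mul_neg, Complex.I_mul_I, neg_neg, hI, ← ih1, ← ih2]
    constructor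
    · cases m with
      | zero => simp [chebT, chebU, hc]
      | succ k =>
        have hT : chebT ((k + 1 + 1 : ℕ) : ℤ) (cosPhi x) =
            cosPhi x * chebT ((k + 1 : ℕ) : ℤ) (cosPhi x)
              - (1 - cosPhi x ^ 2) * chebU k (cosPhi x) := by
          have := congrArg (Polynomial.eval (cosPhi x)) (Chebyshev.T_eq_X_mul_T_sub_pol_U ℝ k)
          simp only [eval_sub, eval_mul, eval_X, eval_one, eval_pow] at this
          unfold chebT chebU
          push_cast
          rw [show (k : ℤ) + 1 + 1 = k + 2 by ring]
          exact this
        have e : ((k + 1 : ℕ) : ℤ) - 1 = k := by push_cast; ring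
        rw [hT, e, ← hc, ← hs]
        -- The factor `ρ²` is kept so that this also holds on the axis, where `cosPhi` and `sinPhi`
        -- are both `0` by convention and their squares do not add up to `1`.
        have h2 : ρ ^ 2 * (1 - cosPhi x ^ 2) = ρ ^ 2 * sinPhi x ^ 2 := by
          have h3 : (ρ * cosPhi x) ^ 2 + (ρ * sinPhi x) ^ 2 = ρ ^ 2 := by rw [hc, hs, hρ2]
          linear_combination -h3
        linear_combination (-ρ ^ k * chebU k (cosPhi x)) * h2
    · have hU : chebU (((m + 1 : ℕ) : ℤ) - 1) (cosPhi x) =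
          cosPhi x * chebU ((m : ℤ) - 1) (cosPhi x) + chebT m (cosPhi x) := by
        have := congrArg (Polynomial.eval (cosPhi x))
          (Chebyshev.U_eq_X_mul_U_add_T ℝ ((m : ℤ) - 1))
        simp only [eval_add, eval_mul, eval_X] at this
        unfold chebT chebU
        push_cast
        rw [show (m : ℤ) + 1 - 1 = m - 1 + 1 by ring, this, sub_add_cancel]
      rw [hU, ← hc, ← hs]
      ring

lemma norm_mul_sqrt {x : E3} (hx : x ≠ 0) :
    √(1 - cosTheta x ^ 2) = √(x 1 ^ 2 + x 2 ^ 2) / ‖x‖ := by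
  have hr : 0 < ‖x‖ := norm_pos_iff.2 hx
  rw [sq_add_sq_eq hx, Real.sqrt_mul (by positivity), Real.sqrt_sq hr.le]
  unfold cosTheta
  field_simp

lemma norm_pow_mul_assocLegendre (n m : ℕ) {x : E3} (hx : x ≠ 0) :
    ‖x‖ ^ n * assocLegendre n m (cosTheta x) = zonal n m x * √(x 1 ^ 2 + x 2 ^ 2) ^ m := by
  have hr : ‖x‖ ≠ 0 := norm_ne_zero_iff.2 hx
  rw [zonal_eq n m hx, assocLegendre, norm_mul_sqrt hx, div_pow]
  unfold legendreDeriv cosTheta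
  ring

lemma solid_one_eq (n m : ℕ) {x : E3} (hx : x ≠ 0) :
    ‖x‖ ^ n * (assocLegendre n m (cosTheta x) * chebT m (cosPhi x)) = solid 1 n m x := by
  rw [← mul_assoc, norm_pow_mul_assocLegendre n m hx, mul_assoc, (planar_eq_chebyshev m x).1,
    solid]

lemma solid_neg_I_eq (n m : ℕ) {x : E3} (hx : x ≠ 0) :
    ‖x‖ ^ n * (assocLegendre n m (cosTheta x) * (sinPhi x * chebU (m - 1) (cosPhi x))) =
      solid (-Complex.I) n m x := by
  rw [← mul_assoc, norm_pow_mul_assocLegendre n m hx, mul_assoc, (planar_eq_chebyshev m x).2,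
    solid]

/-- The derivative involves a zonal factor of degree `n + 1` and order `p + 1`; `zonal_order` trades
it for orders `p` and `p + 2` in degree `n`, and the planar recursion matches these with harmonics
of the same order. -/
lemma neg_pd_one_potential_succ (θ : ℂ) (n p : ℕ) (x : E3) :
    -pd 1 (potential θ n (p + 1)) x = 1 / 4 * solid θ n (p + 2) x
      - 1 / 4 * (n + p + 2) * (n + p + 1) * solid θ n p x := by
  have h := zonal_order n p x
  have h1 := planar_succ θ (p + 1) x
  have h2 := planar_succ θ p x
  have h3 := planar_I_succ θ p x
  simp only [pd_potential]
  rw [pd_solid θ n (p + 1) (i := 1) (by decide), (pd_planar_succ θ p x).2.1]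
  unfold solid
  rw [h1, h3, h2]
  linear_combination (1 / 4 * planar θ p x) * h

lemma neg_pd_two_potential_succ (θ : ℂ) (n p : ℕ) (x : E3) :
    -pd 2 (potential θ n (p + 1)) x = 1 / 4 * solid (-Complex.I * θ) n (p + 2) x
      + 1 / 4 * (n + p + 2) * (n + p + 1) * solid (-Complex.I * θ) n p x := by
  have h := zonal_order n p x
  have h1 := planar_I_succ θ (p + 1) x
  have h2 := planar_succ θ p x
  have h3 := planar_I_succ θ p x
  simp only [pd_potential]
  rw [pd_solid θ n (p + 1) (i := 2) (by decide), (pd_planar_succ θ p x).2.2]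
  unfold solid
  rw [neg_mul Complex.I θ, planar_neg, planar_neg, h1, h3, h2]
  linear_combination (1 / 4 * planar (Complex.I * θ) p x) * h

lemma neg_pd_potential_zero (θ : ℂ) (n : ℕ) {i : Fin 3} (hi : i ≠ 0) (x : E3) :
    -pd i (potential θ n 0) x = 1 / 2 * (x i * zonal n 1 x) * θ.re := by
  simp only [pd_potential]
  rw [pd_solid θ n 0 hi, pd_planar_zero, planar_zero]
  ring

lemma XPoly_eq_conjGrad (n m : ℕ) {x : E3} (hx : x ≠ 0) :
    XPoly n m x = conjGrad (potential 1 n m) x := by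
  have hre : ‖x‖ ^ n * (((n : ℝ) + m + 1) / 2 * assocLegendre n m (cosTheta x)
      * chebT m (cosPhi x)) = pd 0 (potential 1 n m) x := by
    rw [pd_zero_potential, ← solid_one_eq n m hx]
    ring
  cases m with
  | zero =>
    have h1 := norm_pow_mul_assocLegendre n 1 hx
    have hc := sqrt_mul_cosPhi x
    have hs := sqrt_mul_sinPhi x
    -- The convention for order `-1`, cleared of denominators. For `n = 0` the division by zero is
    -- harmless because `P₀¹ = 0`.
    have hpred : (n : ℝ) * ((n + 1) * assocLegendrePred n 0 (cosTheta x)) =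
        -assocLegendre n 1 (cosTheta x) := by
      rcases Nat.eq_zero_or_pos n with rfl | hn
      · simp [assocLegendre, legendre]
      · have : (n : ℝ) ≠ 0 := by positivity
        simp only [assocLegendrePred]
        field_simp
    ext
    · simpa [XPoly, conjGrad] using hre
    · simp only [XPoly, conjGrad, quaternion_smul_mk,
        neg_pd_potential_zero 1 n (i := 1) (by decide)]
      simp [chebT]
      linear_combination (1 / 2 * cosPhi x) * h1 + (1 / 2 * zonal n 1 x) * hc
        - 1 / 4 * ‖x‖ ^ n * cosPhi x * hpred
    · simp only [XPoly, conjGrad, quaternion_smul_mk,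
        neg_pd_potential_zero 1 n (i := 2) (by decide)]
      simp [chebU]
      linear_combination (1 / 2 * sinPhi x) * h1 + (1 / 2 * zonal n 1 x) * hs
        - 1 / 4 * ‖x‖ ^ n * sinPhi x * hpred
    · simp [XPoly, conjGrad]
  | succ p =>
    have e1 : (((p + 1 : ℕ) : ℤ) + 1) = ((p + 2 : ℕ) : ℤ) := by push_cast; ring
    have e2 : (((p + 1 : ℕ) : ℤ) - 1) = (p : ℤ) := by push_cast; ring
    have e3 : (((p + 1 : ℕ) : ℤ)) = ((p + 2 : ℕ) : ℤ) - 1 := by push_cast; ring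
    have e4 : (((p + 1 : ℕ) : ℤ) - 2) = (p : ℤ) - 1 := by push_cast; ring
    ext
    · simpa [XPoly, conjGrad] using hre
    · simp only [XPoly, conjGrad, neg_pd_one_potential_succ, assocLegendrePred,
        quaternion_smul_mk]
      rw [e1, e2, ← solid_one_eq n (p + 2) hx, ← solid_one_eq n p hx]
      push_cast
      ring
    · simp only [XPoly, conjGrad, neg_pd_two_potential_succ, assocLegendrePred,
        quaternion_smul_mk, mul_one]
      rw [e4, e3, ← solid_neg_I_eq n (p + 2) hx, ← solid_neg_I_eq n p hx]
      push_cast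
      ring
    · simp [XPoly, conjGrad]

lemma YPoly_eq_conjGrad (n p : ℕ) {x : E3} (hx : x ≠ 0) :
    YPoly n (p + 1) x = conjGrad (potential (-Complex.I) n (p + 1)) x := by
  have e1 : (((p + 1 : ℕ) : ℤ) + 1) = ((p + 2 : ℕ) : ℤ) := by push_cast; ring
  have e2 : (((p + 1 : ℕ) : ℤ) - 1) = (p : ℤ) := by push_cast; ring
  have e3 : (((p + 1 : ℕ) : ℤ)) = ((p + 2 : ℕ) : ℤ) - 1 := by push_cast; ring
  have e4 : (((p + 1 : ℕ) : ℤ) - 2) = (p : ℤ) - 1 := by push_cast; ring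
  ext
  · simp only [YPoly, conjGrad, pd_zero_potential, quaternion_smul_mk]
    rw [← solid_neg_I_eq n (p + 1) hx]
    ring
  · simp only [YPoly, conjGrad, neg_pd_one_potential_succ, assocLegendrePred,
      quaternion_smul_mk]
    rw [e4, e3, ← solid_neg_I_eq n (p + 2) hx, ← solid_neg_I_eq n p hx]
    push_cast
    ring
  · simp only [YPoly, conjGrad, neg_pd_two_potential_succ, assocLegendrePred,
      quaternion_smul_mk, mul_neg, neg_mul, neg_neg, Complex.I_mul_I]
    simp only [solid, planar_neg]
    rw [e1, e2]
    have h1 := solid_one_eq n (p + 2) hx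
    have h2 := solid_one_eq n p hx
    simp only [solid] at h1 h2
    push_cast at h1 h2 ⊢
    linear_combination (-1 / 4) * h1 - 1 / 4 * ((n : ℝ) + p + 2) * (n + p + 1) * h2
  · simp [YPoly, conjGrad]

/-! ### From monogenic functions to harmonic fields -/

/-- The components `re`, `imI`, `imJ`, `imK` as continuous linear forms. -/
def compCLM (k : Fin 4) : ℍ[ℝ] →L[ℝ] ℝ :=
  LinearMap.toContinuousLinearMap
    { toFun := fun q => ![q.re, q.imI, q.imJ, q.imK] k
      map_add' := fun p q => by fin_cases k <;> simp
      map_smul' := fun c q => by fin_cases k <;> simp }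

lemma compCLM_apply (k : Fin 4) (q : ℍ[ℝ]) : compCLM k q = ![q.re, q.imI, q.imJ, q.imK] k := rfl

lemma imK_eq_zero_of_mem_reduced {q : ℍ[ℝ]} (hq : q ∈ reduced) : q.imK = 0 := by
  have : reduced ≤ LinearMap.ker (compCLM 3).toLinearMap := by
    refine Submodule.span_le.2 ?_
    rintro x (rfl | rfl | rfl) <;> exact LinearMap.mem_ker.2 rfl
  simpa [compCLM_apply] using this hq

/-- The conjugate components of a quaternion-valued function. -/
def conjField (f : E3 → ℍ[ℝ]) (i : Fin 3) (x : E3) : ℝ := ![(f x).re, -(f x).imI, -(f x).imJ] i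

lemma pd_comp_quaternion {f : E3 → ℍ[ℝ]} {x : E3} (hf : DifferentiableAt ℝ f x) (k : Fin 4)
    (i : Fin 3) : pd i (fun y => compCLM k (f y)) x = compCLM k (partialD i f x) := by
  unfold pd partialD
  have : HasFDerivAt (fun y => compCLM k (f y)) _ x :=
    (compCLM k).hasFDerivAt.comp x hf.hasFDerivAt
  rw [this.fderiv]
  rfl

lemma pd_neg (u : E3 → ℝ) (i : Fin 3) (x : E3) : pd i (fun y => -u y) x = -pd i u x := by
  unfold pd
  rw [fderiv_fun_neg]
  rfl

/-- The real part of `D f = 0` is the divergence equation and its three imaginary parts are the curl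
equations. This uses that the `e₁e₂` component of `f`, hence of each partial derivative, is zero. -/
lemma IsMonogenicOn.isHarmonicField {f : E3 → ℍ[ℝ]} (hf : IsMonogenicOn f B) :
    IsHarmonicField (conjField f) := by
  have hd : ∀ x ∈ B, DifferentiableAt ℝ f x := fun x hx =>
    (hf.contDiffOn.contDiffAt (isOpen_B.mem_nhds hx)).differentiableAt one_ne_zero
  have h0 : conjField f 0 = fun y => compCLM 0 (f y) := rfl
  have h1 : conjField f 1 = fun y => -compCLM 1 (f y) := rfl
  have h2 : conjField f 2 = fun y => -compCLM 2 (f y) := rfl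
  have hc : ∀ k, ContDiffOn ℝ 1 (fun y => compCLM k (f y)) B := fun k =>
    (compCLM k).contDiff.comp_contDiffOn hf.contDiffOn
  have hpd0 : ∀ x ∈ B, ∀ i, pd i (conjField f 0) x = (partialD i f x).re := fun x hx i => by
    rw [h0, pd_comp_quaternion (hd x hx)]
    rfl
  have hpd1 : ∀ x ∈ B, ∀ i, pd i (conjField f 1) x = -(partialD i f x).imI := fun x hx i => by
    rw [h1, pd_neg, pd_comp_quaternion (hd x hx)]
    rfl
  have hpd2 : ∀ x ∈ B, ∀ i, pd i (conjField f 2) x = -(partialD i f x).imJ := fun x hx i => by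
    rw [h2, pd_neg, pd_comp_quaternion (hd x hx)]
    rfl
  have hpd3 : ∀ x ∈ B, ∀ i, (partialD i f x).imK = 0 := fun x hx i => by
    have e : (partialD i f x).imK = pd i (fun y => compCLM 3 (f y)) x := by
      rw [pd_comp_quaternion (hd x hx)]
      rfl
    have hev : (fun y => compCLM 3 (f y)) =ᶠ[nhds x] fun _ => (0 : ℝ) := by
      filter_upwards [isOpen_B.mem_nhds hx] with y hy
      exact imK_eq_zero_of_mem_reduced (hf.mem_reduced y hy)
    rw [e, pd_congr hev, pd_const]
  have hD : ∀ x ∈ B, _ := fun x hx => Quaternion.ext_iff.1 (hf.cauchyRiemann_eq_zero x hx)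
  have c1 : e1.re = 0 ∧ e1.imI = 1 ∧ e1.imJ = 0 ∧ e1.imK = 0 := ⟨rfl, rfl, rfl, rfl⟩
  have c2 : e2.re = 0 ∧ e2.imI = 0 ∧ e2.imJ = 1 ∧ e2.imK = 0 := ⟨rfl, rfl, rfl, rfl⟩
  simp only [cauchyRiemann, Quaternion.re_add, Quaternion.imI_add, Quaternion.imJ_add,
    Quaternion.imK_add, Quaternion.re_mul, Quaternion.imI_mul, Quaternion.imJ_mul,
    Quaternion.imK_mul, Quaternion.re_zero, Quaternion.imI_zero, Quaternion.imJ_zero,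
    Quaternion.imK_zero, c1, c2] at hD
  refine ⟨fun i => ?_, fun x hx i j => ?_, fun x hx => ?_⟩
  · fin_cases i
    · exact hc 0
    · exact (hc 1).neg
    · exact (hc 2).neg
  · obtain ⟨a, b, c, d⟩ := hD x hx
    have k0 := hpd3 x hx 0
    have k1 := hpd3 x hx 1
    have k2 := hpd3 x hx 2
    fin_cases i <;> fin_cases j <;>
      simp only [Fin.zero_eta, Fin.mk_one, Fin.reduceFinMk, hpd0 x hx, hpd1 x hx, hpd2 x hx] <;>
      linarith
  · obtain ⟨a, -, -, -⟩ := hD x hx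
    rw [Fin.sum_univ_three, hpd0 x hx, hpd1 x hx, hpd2 x hx]
    linarith

/-! ### Smooth harmonic functions: means and pointwise bounds -/

lemma WeaklyHarmonic.neg {v : E3 → ℝ} (hv : WeaklyHarmonic v) :
    WeaklyHarmonic fun x => -v x := by
  intro Φ h1 h2 h3
  have := hv Φ h1 h2 h3
  simp only [pd_neg, mul_neg, Finset.sum_neg_distrib]
  rw [integral_neg, this, neg_zero]

lemma weaklyHarmonic_of_laplace {v : E3 → ℝ} (hv : ContDiff ℝ ∞ v)
    (h : ∀ x, ∑ i, pd i (pd i v) x = 0) : WeaklyHarmonic v := by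
  intro Φ hΦ hc hs
  have hvi : ∀ i, ContDiff ℝ ∞ (pd i v) := fun i => contDiff_pd hv (by simp) i
  rw [integral_finsetSum]
  · have h1 : ∀ i, ∫ x, pd i Φ x * pd i v x = -∫ x, Φ x * pd i (pd i v) x := fun i => by
      rw [integral_mul_pd (hΦ.of_le (by simp)) hc hs ((hvi i).of_le (by simp)).contDiffOn i,
        neg_neg]
    simp only [h1, Finset.sum_neg_distrib, neg_eq_zero]
    rw [← integral_finsetSum _ fun i _ => integrable_test_mul hΦ.continuous hc hs
      (contDiff_pd (m := 0) (hvi i) (by simp) i).continuous.continuousOn]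
    simp only [← Finset.mul_sum, h, mul_zero, integral_zero]
  · exact fun i _ => integrable_test_mul (contDiff_pd (m := 0) hΦ (by simp) i).continuous
      (HasCompactSupport.pd hc i) ((tsupport_pd_subset Φ i).trans hs)
      (hvi i).continuous.continuousOn

/-- Mean value property for smooth harmonic functions. -/
lemma setIntegral_eq_of_laplace {v : E3 → ℝ} (hv : ContDiff ℝ ∞ v)
    (h : ∀ x, ∑ i, pd i (pd i v) x = 0) : ∫ x in B, v x = v 0 * volume.real B :=
  setIntegral_mean_value (hv.of_le (by simp)).contDiffOn (weaklyHarmonic_of_laplace hv h)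
    (integrableOn_B_of_continuous hv.continuous)

/-- `xᵢ² - ‖x‖² / 3` is harmonic and vanishes at the origin, so its mean is zero and the second
moment of the ball divides by three. -/
lemma setIntegral_coord_sq (i : Fin 3) :
    ∫ x in B, x i ^ 2 = 1 / 5 * volume.real B := by
  have c : ContDiff ℝ ∞ fun x : E3 => x i := by fun_prop
  have hn : ContDiff ℝ ∞ fun x : E3 => ‖x‖ ^ 2 := contDiff_norm_sq ℝ
  have dpd : ∀ {u : E3 → ℝ}, ContDiff ℝ ∞ u → ∀ j, Differentiable ℝ (pd j u) := fun hu j =>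
    (contDiff_pd (m := ∞) hu (by simp) j).differentiable (by simp)
  have key := setIntegral_eq_of_laplace (v := fun x => x i * x i - 1 / 3 * ‖x‖ ^ 2)
    ((c.mul c).sub (contDiff_const.mul hn)) (by
      intro x
      have h1 := laplacian_mul c c x
      have h2 := laplacian_radial_mul (A := fun s => s) contDiff_id
        (p := fun _ => (1 : ℝ)) contDiff_const x
      simp only [mul_one] at h2
      have e : ∀ j, pd j (fun x => x i * x i - 1 / 3 * ‖x‖ ^ 2) = fun x =>
          pd j (fun x => x i * x i) x - 1 / 3 * pd j (fun x => ‖x‖ ^ 2) x := by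
        intro j
        funext y
        rw [pd_sub ((c.mul c).differentiable (by simp) y)
          (((hn.differentiable (by simp)).const_mul _) y),
          pd_const_mul (hn.differentiable (by simp) y)]
      have e' : ∀ j, pd j (pd j (fun x => x i * x i - 1 / 3 * ‖x‖ ^ 2)) x =
          pd j (pd j (fun x => x i * x i)) x - 1 / 3 * pd j (pd j (fun x => ‖x‖ ^ 2)) x := by
        intro j
        rw [e, pd_sub (dpd (c.mul c) j x) (((dpd hn j).const_mul _) x), pd_const_mul (dpd hn j x)]
      have hcc : ∀ j, pd j (fun x : E3 => x i) = fun _ => if j = i then 1 else 0 := fun j =>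
        funext fun y => pd_coord j i y
      simp only [hcc, pd_const] at h1
      simp only [pd_const, show ∀ j : Fin 3, pd j (fun _ : E3 => (1 : ℝ)) = fun _ => 0 from
        fun j => funext fun y => pd_const j 1 y] at h2
      simp only [e', Finset.sum_sub_distrib, ← Finset.mul_sum]
      rw [h1, h2]
      simp
      norm_num)
  rw [integral_sub (integrableOn_B_of_continuous (c.mul c).continuous)
    (integrableOn_B_of_continuous (contDiff_const.mul hn).continuous), integral_const_mul,
    setIntegral_normSq] at key
  simp only [pow_two]
  simp at key
  linarith

lemma pd_comp_affine {v : E3 → ℝ} (hv : Differentiable ℝ v) (e : E3) (t : ℝ) (i : Fin 3) (x : E3) :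
    pd i (fun y => v (e + t • y)) x = t * pd i v (e + t • x) := by
  unfold pd
  have h1 : HasFDerivAt (fun y : E3 => e + t • y) (t • ContinuousLinearMap.id ℝ E3) x :=
    ((hasFDerivAt_id x).const_smul t).const_add e
  have h2 : HasFDerivAt (fun y => v (e + t • y)) _ x := (hv _).hasFDerivAt.comp x h1
  rw [h2.fderiv]
  simp

lemma pd_homogeneous {G : E3 → ℝ} (hG : Differentiable ℝ G) {n : ℕ}
    (h : ∀ t : ℝ, 0 < t → ∀ x, G (t • x) = t ^ (n + 1) * G x) (i : Fin 3) {t : ℝ} (ht : 0 < t)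
    (x : E3) : pd i G (t • x) = t ^ n * pd i G x := by
  have h1 := pd_comp_affine hG 0 t i x
  simp only [zero_add] at h1
  rw [show (fun y => G (t • y)) = fun y => t ^ (n + 1) * G y from funext (h t ht),
    pd_const_mul (hG x)] at h1
  have : t * pd i G (t • x) = t * (t ^ n * pd i G x) := by rw [← h1]; ring
  exact mul_left_cancel₀ ht.ne' this

lemma solid_homogeneous (θ : ℂ) (n m : ℕ) {t : ℝ} (ht : 0 < t) (x : E3) :
    solid θ (n + 1) m (t • x) = t ^ (n + 1) * solid θ (n + 1) m x := by
  by_cases hx : x = 0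
  · have h0 : solid θ (n + 1) m 0 = 0 := by
      -- The formula through `zonal_eq` is unavailable at the origin; Euler's identity with positive
      -- degree gives the value `0` there.
      have := solid_euler θ n m 0
      simp only [PiLp.zero_apply, zero_mul, Finset.sum_const_zero] at this
      have hn : (n : ℝ) + 1 ≠ 0 := by positivity
      exact (mul_eq_zero.1 this.symm).resolve_left hn
    rw [hx, smul_zero, h0, mul_zero]
  · have hr : ‖x‖ ≠ 0 := norm_ne_zero_iff.2 hx
    have htx : t • x ≠ 0 := smul_ne_zero ht.ne' hx
    have hp : planar θ m (t • x) = t ^ m * planar θ m x := by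
      unfold planar
      simp only [PiLp.smul_apply, smul_eq_mul, Complex.ofReal_mul]
      rw [show θ * ((t : ℂ) * (x 1 : ℂ) + t * x 2 * Complex.I) ^ m =
        ((t ^ m : ℝ) : ℂ) * (θ * ((x 1 : ℂ) + x 2 * Complex.I) ^ m) by
          push_cast
          rw [mul_assoc (t : ℂ), ← mul_add, mul_pow]
          ring, Complex.re_ofReal_mul]
    unfold solid
    rw [zonal_eq _ _ hx, zonal_eq _ _ htx, hp, norm_smul, Real.norm_of_nonneg ht.le]
    have e : (t • x) 0 / (t * ‖x‖) = x 0 / ‖x‖ := by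
      simp only [PiLp.smul_apply, smul_eq_mul]
      field_simp
    rw [e, mul_pow, mul_pow]
    field_simp

lemma potential_homogeneous (θ : ℂ) (n m : ℕ) {t : ℝ} (ht : 0 < t) (x : E3) :
    potential θ n m (t • x) = t ^ (n + 1) * potential θ n m x := by
  unfold potential
  rw [solid_homogeneous θ n m ht]
  ring

/-- Comparison of the mean over a half-size ball around a unit vector with the mean over the
unit ball, for homogeneous functions. -/
lemma setIntegral_sq_translate_le {v : E3 → ℝ} (hv : Continuous v) {n : ℕ}
    (h : ∀ t : ℝ, 0 < t → ∀ x, v (t • x) = t ^ n * v x) {e : E3} (he : ‖e‖ = 1) :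
    ∫ y in B, v (e + (1 / 2 : ℝ) • y) ^ 2 ≤ 27 * (9 / 4) ^ n * ∫ y in B, v y ^ 2 := by
  -- The ball of radius `1/2` about a unit vector lies in the ball of radius `3/2` about `0`. The
  -- change of variables costs `8 · 27/8 = 27`, and homogeneity `(3/2)^(2n) = (9/4)^n`.
  set L : E3 → ℝ := B.indicator fun z => v ((3 / 2 : ℝ) • z) ^ 2 with hL
  have hLi : Integrable L := by
    rw [hL, integrable_indicator_iff isOpen_B.measurableSet]
    exact integrableOn_B_of_continuous (by fun_prop)
  have hK : Integrable fun z : E3 => L ((2 / 3 : ℝ) • z) := hLi.comp_smul (by norm_num)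
  have hK' : Integrable fun y : E3 => L ((2 / 3 : ℝ) • (e + (1 / 2 : ℝ) • y)) :=
    (hK.comp_add_left e).comp_smul (by norm_num)
  have hle : ∫ y in B, v (e + (1 / 2 : ℝ) • y) ^ 2 ≤
      ∫ y, L ((2 / 3 : ℝ) • (e + (1 / 2 : ℝ) • y)) := by
    rw [← integral_indicator isOpen_B.measurableSet]
    refine integral_mono ?_ hK' fun y => ?_
    · rw [integrable_indicator_iff isOpen_B.measurableSet]
      exact integrableOn_B_of_continuous (by fun_prop)
    · by_cases hy : y ∈ B
      · have hmem : (2 / 3 : ℝ) • (e + (1 / 2 : ℝ) • y) ∈ B := by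
          rw [mem_B] at hy ⊢
          have h1 : ‖e + (1 / 2 : ℝ) • y‖ ≤ 1 + 1 / 2 * ‖y‖ := by
            refine (norm_add_le _ _).trans ?_
            rw [he, norm_smul]
            norm_num
          rw [norm_smul, Real.norm_of_nonneg (by norm_num)]
          linarith
        simp only [hL, Set.indicator_of_mem hy, Set.indicator_of_mem hmem, smul_smul]
        norm_num
      · simp only [Set.indicator_of_notMem hy]
        exact Set.indicator_nonneg (fun _ _ => sq_nonneg _) _
  have e1 : ∫ y, L ((2 / 3 : ℝ) • (e + (1 / 2 : ℝ) • y)) = 8 * ∫ z, L ((2 / 3 : ℝ) • z) := by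
    have := Measure.integral_comp_smul (volume : Measure E3)
      (fun z : E3 => L ((2 / 3 : ℝ) • (e + z))) (1 / 2)
    rw [this, integral_add_left_eq_self (fun z : E3 => L ((2 / 3 : ℝ) • z)) e]
    norm_num [abs_of_pos]
  have e2 : ∫ z, L ((2 / 3 : ℝ) • z) = 27 / 8 * ∫ z, L z := by
    rw [Measure.integral_comp_smul (volume : Measure E3) L (2 / 3)]
    norm_num [abs_of_pos]
  have e3 : ∫ z, L z = (9 / 4) ^ n * ∫ z in B, v z ^ 2 := by
    rw [hL, integral_indicator isOpen_B.measurableSet, ← integral_const_mul]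
    congr 1
    funext z
    rw [h _ (by norm_num), mul_pow, ← pow_mul, mul_comm n 2, pow_mul]
    norm_num
  rw [e1, e2, e3] at hle
  linarith

/-- Pointwise bound of a homogeneous harmonic function by its mean square over the ball. -/
lemma sq_mul_le_of_homogeneous {v : E3 → ℝ} (hv : ContDiff ℝ ∞ v)
    (hl : ∀ x, ∑ i, pd i (pd i v) x = 0) {n : ℕ}
    (h : ∀ t : ℝ, 0 < t → ∀ x, v (t • x) = t ^ n * v x) {x : E3} (hx : x ≠ 0) :
    v x ^ 2 * volume.real B ≤ 27 * (9 / 4) ^ n * (‖x‖ ^ n) ^ 2 * ∫ y in B, v y ^ 2 := by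
  have hr : 0 < ‖x‖ := norm_pos_iff.2 hx
  have dv : Differentiable ℝ v := hv.differentiable (by simp)
  have dvi : ∀ i, Differentiable ℝ (pd i v) := fun i =>
    (contDiff_pd (m := ∞) hv (by simp) i).differentiable (by simp)
  have unit : ∀ e : E3, ‖e‖ = 1 →
      v e ^ 2 * volume.real B ≤ 27 * (9 / 4) ^ n * ∫ y in B, v y ^ 2 := by
    intro e he
    refine le_trans ?_ (setIntegral_sq_translate_le hv.continuous h he)
    set w : E3 → ℝ := fun y => v (e + (1 / 2 : ℝ) • y) with hw
    have hws : ContDiff ℝ ∞ w := hv.comp (by fun_prop)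
    have hwl : ∀ y, ∑ i, pd i (pd i w) y = 0 := by
      intro y
      have : ∀ i, pd i (pd i w) y = 1 / 4 * pd i (pd i v) (e + (1 / 2 : ℝ) • y) := by
        intro i
        have da : DifferentiableAt ℝ (fun y : E3 => pd i v (e + (1 / 2 : ℝ) • y)) y :=
          DifferentiableAt.comp (g := pd i v) (f := fun y => e + (1 / 2 : ℝ) • y) y
            (dvi i _) (by fun_prop)
        rw [show pd i w = fun y => 1 / 2 * pd i v (e + (1 / 2 : ℝ) • y) from
          funext fun y => pd_comp_affine dv e (1 / 2) i y,
          pd_const_mul da, pd_comp_affine (dvi i)]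
        ring
      simp only [this]
      rw [← Finset.mul_sum, hl, mul_zero]
    have hmv := setIntegral_eq_of_laplace hws hwl
    have hw0 : w 0 = v e := by simp [hw]
    rw [hw0] at hmv
    -- Nonnegative variance, combined with the mean value property of `w`, gives `v(e)² |B| ≤ ∫ w²`.
    have hpos : 0 ≤ ∫ y in B, (w y - v e) ^ 2 := integral_nonneg fun _ => sq_nonneg _
    have i1 : IntegrableOn (fun y => w y ^ 2) B :=
      integrableOn_B_of_continuous (hws.continuous.pow 2)
    have i2 : IntegrableOn (fun y => 2 * v e * w y) B :=
      integrableOn_B_of_continuous (continuous_const.mul hws.continuous)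
    have i3 : IntegrableOn (fun y => w y ^ 2 - 2 * v e * w y) B := i1.sub i2
    have hexp : ∫ y in B, (w y - v e) ^ 2 =
        (∫ y in B, w y ^ 2) - 2 * v e * (∫ y in B, w y) + v e ^ 2 * volume.real B := by
      rw [← integral_const_mul, ← integral_sub i1 i2,
        show v e ^ 2 * volume.real B = ∫ y in B, v e ^ 2 by simp [mul_comm],
        ← integral_add i3 (integrableOn_B_of_continuous continuous_const)]
      congr 1
      funext y
      ring
    rw [hexp, hmv] at hpos
    linarith
  have hu := unit (‖x‖⁻¹ • x) (by rw [norm_smul, norm_inv, norm_norm, inv_mul_cancel₀ hr.ne'])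
  have hx' : v x = ‖x‖ ^ n * v (‖x‖⁻¹ • x) := by
    rw [← h _ hr, smul_smul, mul_inv_cancel₀ hr.ne', one_smul]
  rw [hx']
  have := mul_le_mul_of_nonneg_left hu (sq_nonneg (‖x‖ ^ n))
  linarith

/-! ### Estimates of single Fourier terms -/

/-- Integrals against a function dominated by a radial weight only feel the defect
`1 - |u 0|`. -/
lemma abs_setIntegral_mul_le {u g : E3 → ℝ} (hu : ContDiffOn ℝ 1 u B) (hw : WeaklyHarmonic u)
    (hi : IntegrableOn u B) (h1 : ∀ x ∈ B, |u x| ≤ 1) (hg : Continuous g)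
    (hg0 : ∫ x in B, g x = 0) {p : ℝ → ℝ} (hp : ContDiff ℝ ∞ p) {M : ℝ}
    (hM : ∀ x ∈ B, |g x| ≤ M * p (‖x‖ ^ 2)) :
    |∫ x in B, g x * u x| ≤ M * ((1 - |u 0|) * ∫ x in B, p (‖x‖ ^ 2)) := by
  have hpc : Continuous (fun x : E3 => p (‖x‖ ^ 2)) := (contDiff_radial hp).continuous
  have bmul : ∀ {k w : E3 → ℝ}, Continuous k → IntegrableOn w B →
      IntegrableOn (fun x => k x * w x) B := by
    intro k w hk hwi
    obtain ⟨C, hC⟩ := (isCompact_closedBall (0 : E3) 1).exists_bound_of_continuousOn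
      hk.continuousOn
    refine hwi.bdd_mul hk.aestronglyMeasurable ?_ (c := C)
    filter_upwards [ae_restrict_mem isOpen_B.measurableSet] with x hx
    exact hC x (Metric.ball_subset_closedBall hx)
  have oneSided : ∀ w : E3 → ℝ, ContDiffOn ℝ 1 w B → WeaklyHarmonic w → IntegrableOn w B →
      (∀ x ∈ B, w x ≤ 1) →
      |∫ x in B, g x * w x| ≤ M * ((1 - w 0) * ∫ x in B, p (‖x‖ ^ 2)) := by
    intro w hwc hww hwi hw1
    have hone : IntegrableOn (fun _ : E3 => (1 : ℝ)) B :=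
      integrableOn_B_of_continuous continuous_const
    -- The zero mean of `g` allows `w` to be replaced by the nonnegative function `1 - w`, whose
    -- weighted mean is known exactly.
    have e1 : ∫ x in B, g x * (1 - w x) = -∫ x in B, g x * w x := by
      simp only [mul_sub, mul_one]
      rw [integral_sub (integrableOn_B_of_continuous hg) (bmul hg hwi), hg0, zero_sub]
    have e2 : ∫ x in B, p (‖x‖ ^ 2) * (1 - w x) = (1 - w 0) * ∫ x in B, p (‖x‖ ^ 2) := by
      simp only [mul_sub, mul_one]
      rw [integral_sub (integrableOn_B_of_continuous hpc) (bmul hpc hwi),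
        setIntegral_weight_mul hwc hww hwi hp]
      ring
    rw [← abs_neg, ← e1, ← e2, ← integral_const_mul]
    refine (abs_integral_le_integral_abs).trans ?_
    refine setIntegral_mono_on (bmul hg (hone.sub hwi)).abs
      ((bmul hpc (hone.sub hwi)).const_mul M) isOpen_B.measurableSet fun x hx => ?_
    have hnn : 0 ≤ 1 - w x := by linarith [hw1 x hx]
    rw [abs_mul, abs_of_nonneg hnn, ← mul_assoc]
    exact mul_le_mul_of_nonneg_right (hM x hx) hnn
  rcases le_total 0 (u 0) with h0 | h0
  · rw [abs_of_nonneg h0]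
    exact oneSided u hu hw hi fun x hx => (abs_le.1 (h1 x hx)).2
  · rw [abs_of_nonpos h0]
    have := oneSided (fun x => -u x) hu.neg hw.neg hi.neg fun x hx => by
      linarith [(abs_le.1 (h1 x hx)).1]
    simpa only [mul_neg, integral_neg, abs_neg] using this

lemma sq_norm_eq (q : ℍ[ℝ]) : ‖q‖ ^ 2 = q.re ^ 2 + q.imI ^ 2 + q.imJ ^ 2 + q.imK ^ 2 := by
  rw [sq, ← Quaternion.normSq_eq_norm_mul_self, Quaternion.normSq_def']

lemma re_conjGrad (G : E3 → ℝ) (x : E3) : (conjGrad G x).re = pd 0 G x := rfl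

lemma imI_conjGrad (G : E3 → ℝ) (x : E3) : (conjGrad G x).imI = -pd 1 G x := rfl

lemma imJ_conjGrad (G : E3 → ℝ) (x : E3) : (conjGrad G x).imJ = -pd 2 G x := rfl

lemma imK_conjGrad (G : E3 → ℝ) (x : E3) : (conjGrad G x).imK = 0 := rfl

lemma sq_norm_conjGrad (G : E3 → ℝ) (x : E3) : ‖conjGrad G x‖ ^ 2 = ∑ i, pd i G x ^ 2 := by
  rw [sq_norm_eq, Fin.sum_univ_three]
  simp [conjGrad]

lemma abs_conjField_le (f : E3 → ℍ[ℝ]) (i : Fin 3) (x : E3) : |conjField f i x| ≤ ‖f x‖ := by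
  refine abs_le_of_sq_le_sq ?_ (norm_nonneg _)
  rw [sq_norm_eq]
  have h0 := sq_nonneg (f x).re
  have h1 := sq_nonneg (f x).imI
  have h2 := sq_nonneg (f x).imJ
  have h3 := sq_nonneg (f x).imK
  fin_cases i <;> simp [conjField] <;> linarith

lemma IsMonogenicOn.integrableOn_conjField {f : E3 → ℍ[ℝ]} (hf : IsMonogenicOn f B)
    (hb : ∀ x ∈ B, ‖f x‖ < 1) (i : Fin 3) : IntegrableOn (conjField f i) B := by
  have : IsFiniteMeasure (volume.restrict B) :=
    isFiniteMeasure_restrict.2 measure_ball_lt_top.ne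
  refine Integrable.of_bound ?_ 1 ?_
  · exact (hf.isHarmonicField.contDiffOn i).continuousOn.aestronglyMeasurable
      isOpen_B.measurableSet
  · filter_upwards [ae_restrict_mem isOpen_B.measurableSet] with x hx
    exact (abs_conjField_le f i x).trans (hb x hx).le

lemma isHarmonicField_pd {G : E3 → ℝ} (hG : ContDiff ℝ ∞ G)
    (h : ∀ x, ∑ i, pd i (pd i G) x = 0) : IsHarmonicField fun i => pd i G where
  contDiffOn i := ((contDiff_pd (m := ∞) hG (by simp) i).of_le (by simp)).contDiffOn
  curl x _ i j := pd_comm hG i j x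
  div x _ := h x

lemma ae_ne_zero : ∀ᵐ x ∂(volume.restrict B : Measure E3), x ≠ 0 :=
  ae_restrict_of_ae (Measure.ae_ne volume 0)

lemma innerL2_eq_of_conjGrad {P f : E3 → ℍ[ℝ]} {G : E3 → ℝ}
    (hP : ∀ x ≠ 0, P x = conjGrad G x) :
    innerL2 P f = ∫ x in B, ∑ i, pd i G x * conjField f i x := by
  refine integral_congr_ae ?_
  filter_upwards [ae_ne_zero] with x hx
  rw [hP x hx, Fin.sum_univ_three]
  simp only [Quaternion.re_mul, Quaternion.re_star, Quaternion.imI_star, Quaternion.imJ_star,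
    Quaternion.imK_star, re_conjGrad, imI_conjGrad, imJ_conjGrad, imK_conjGrad]
  simp [conjField]
  ring

lemma innerL2_self_of_conjGrad {P : E3 → ℍ[ℝ]} {G : E3 → ℝ}
    (hP : ∀ x ≠ 0, P x = conjGrad G x) :
    innerL2 P P = ∫ x in B, ∑ i, pd i G x * pd i G x := by
  rw [innerL2_eq_of_conjGrad hP]
  refine integral_congr_ae ?_
  filter_upwards [ae_ne_zero] with x hx
  simp only [Fin.sum_univ_three, conjField, hP x hx]
  simp [conjGrad]

lemma innerL2_self_nonneg (P : E3 → ℍ[ℝ]) : 0 ≤ innerL2 P P := by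
  refine integral_nonneg fun x => ?_
  rw [Quaternion.star_mul_self]
  simp

/-- The norm of `P` enters twice, once in the value and once in the coefficient, so normalization
divides by `innerL2 P P`. If that is zero, the inverse is `0` by convention and the bound is
trivial. -/
lemma norm_normalized_mul_le {P f : E3 → ℍ[ℝ]} {x : E3} {b : ℝ} (hb : 0 ≤ b)
    (h : ‖P x‖ * |innerL2 P f| ≤ b * innerL2 P P) :
    ‖normalized P x‖ * |innerL2 (normalized P) f| ≤ b := by
  have hN := innerL2_self_nonneg P
  have hn : 0 ≤ normL2 P := Real.sqrt_nonneg _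
  have h1 : innerL2 (normalized P) f = (normL2 P)⁻¹ * innerL2 P f := by
    unfold innerL2
    rw [← integral_const_mul]
    congr 1
    funext y
    simp [normalized]
  have h2 : ‖normalized P x‖ = (normL2 P)⁻¹ * ‖P x‖ := by
    rw [normalized, norm_smul, norm_inv, Real.norm_of_nonneg hn]
  rw [h1, h2, abs_mul, abs_of_nonneg (inv_nonneg.2 hn)]
  rcases hN.eq_or_lt with h0 | h0
  · simp [normL2, ← h0, hb]
  · have hs : (normL2 P)⁻¹ * (normL2 P)⁻¹ = (innerL2 P P)⁻¹ := by
      rw [← mul_inv, normL2, Real.mul_self_sqrt hN]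
    calc (normL2 P)⁻¹ * ‖P x‖ * ((normL2 P)⁻¹ * |innerL2 P f|)
        = (innerL2 P P)⁻¹ * (‖P x‖ * |innerL2 P f|) := by rw [← hs]; ring
      _ ≤ (innerL2 P P)⁻¹ * (b * innerL2 P P) := by gcongr
      _ = b := by field_simp

/-- The basic estimate of a Fourier term through a radial majorant of the scalar part. -/
lemma norm_mul_abs_innerL2_le {f : E3 → ℍ[ℝ]} (hf : IsMonogenicOn f B)
    (hb : ∀ x ∈ B, ‖f x‖ < 1) {n : ℕ} {κ : ℝ} {G : E3 → ℝ} (hG : IsAxial n κ G) (hκ : 0 < κ)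
    {P : E3 → ℍ[ℝ]} (hP : ∀ x ≠ 0, P x = conjGrad G x) (hg0 : ∫ x in B, pd 0 G x = 0)
    {p : ℝ → ℝ} (hp : ContDiff ℝ ∞ p) {M K L : ℝ} (hM : 0 ≤ M) (hK : 0 ≤ K)
    (hMp : ∀ y ∈ B, |pd 0 G y| ≤ M * p (‖y‖ ^ 2)) {x : E3} (hx : ‖P x‖ ≤ K * M)
    (hL : M ^ 2 * ∫ y in B, p (‖y‖ ^ 2) ≤ L * ∫ y in B, pd 0 G y * pd 0 G y) :
    ‖P x‖ * |innerL2 P f| ≤ K * L * (1 - |(f 0).re|) * innerL2 P P := by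
  have hF := hf.isHarmonicField
  have hFi := hf.integrableOn_conjField hb
  have hGc : ∀ i, Continuous (pd i G) := fun i =>
    (contDiff_pd (m := 0) hG.contDiff (by simp) i).continuous
  have h1 := hG.setIntegral_eq hF hFi
  have h2 := hG.setIntegral_eq (isHarmonicField_pd hG.contDiff hG.laplace)
    fun i => integrableOn_B_of_continuous (hGc i)
  rw [← innerL2_eq_of_conjGrad hP] at h1
  rw [← innerL2_self_of_conjGrad hP] at h2
  have h3 := abs_setIntegral_mul_le (hF.contDiffOn 0) (hF.weaklyHarmonic 0) (hFi 0)
    (fun y hy => (abs_conjField_le f 0 y).trans (hb y hy).le) (hGc 0) hg0 hp hMp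
  have hu : conjField f 0 0 = (f 0).re := rfl
  rw [hu] at h3
  have hu1 : 0 ≤ 1 - |(f 0).re| := by
    have := (abs_conjField_le f 0 0).trans (hb 0 (by simp [B])).le
    rw [hu] at this
    linarith
  set I := ∫ y in B, p (‖y‖ ^ 2)
  set S := ∫ y in B, pd 0 G y * pd 0 G y
  set c : ℝ := (2 * n + 1) * (n + 1)
  have hc : 0 < c := by positivity
  -- `κ` and `c` enter in the same way for `f` and for `P` itself, so both disappear when `h2` is
  -- used in the last line of the calculation.
  have h4 : κ * |innerL2 P f| ≤ c * (M * ((1 - |(f 0).re|) * I)) := by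
    rw [← abs_of_pos hκ, ← abs_mul, h1, abs_mul, abs_of_pos hc]
    gcongr
  refine le_of_mul_le_mul_left ?_ hκ
  calc κ * (‖P x‖ * |innerL2 P f|) = ‖P x‖ * (κ * |innerL2 P f|) := by ring
    _ ≤ K * M * (κ * |innerL2 P f|) := by gcongr
    _ ≤ K * M * (c * (M * ((1 - |(f 0).re|) * I))) := by gcongr
    _ = K * c * (1 - |(f 0).re|) * (M ^ 2 * I) := by ring
    _ ≤ K * c * (1 - |(f 0).re|) * (L * S) := by gcongr
    _ = K * L * (1 - |(f 0).re|) * (c * S) := by ring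
    _ = κ * (K * L * (1 - |(f 0).re|) * innerL2 P P) := by rw [← h2]; ring

/-- By the mean value property it suffices that the derivative vanishes at the origin, and it does
by Euler's identity, its degree `n + 1` being positive. -/
lemma setIntegral_pd_eq_zero {n : ℕ} {κ : ℝ} {G : E3 → ℝ} (hG : IsAxial (n + 1) κ G) (i : Fin 3) :
    ∫ x in B, pd i G x = 0 := by
  rw [setIntegral_eq_of_laplace (contDiff_pd hG.contDiff (by simp) i)
    (laplace_pd hG.contDiff hG.laplace i)]
  have h := euler_pd hG.contDiff hG.euler i 0
  simp only [PiLp.zero_apply, zero_mul, Finset.sum_const_zero] at h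
  have h2 : ((n + 1 : ℕ) : ℝ) + 1 - 1 ≠ 0 := by
    rw [add_sub_cancel_right]
    positivity
  rw [(mul_eq_zero.1 h.symm).resolve_left h2, zero_mul]

/-- Fourier terms of degree at least two. -/
lemma norm_mul_abs_innerL2_le_of_two_le {f : E3 → ℍ[ℝ]} (hf : IsMonogenicOn f B)
    (hb : ∀ x ∈ B, ‖f x‖ < 1) (θ : ℂ) {n m : ℕ} (hm : m ≤ n + 2) {P : E3 → ℍ[ℝ]}
    (hP : ∀ x ≠ 0, P x = conjGrad (potential θ (n + 2) m) x) (hP0 : P 0 = 0) (x : E3) :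
    ‖P x‖ * |innerL2 P f| ≤ ((n : ℝ) + 7) / 4 * ‖x‖ ^ (n + 2) * (81 / 5 * (9 / 4) ^ (n + 2))
      * (1 - |(f 0).re|) * innerL2 P P := by
  have hG := isAxial_potential θ (n + 1) m
  set G := potential θ (n + 2) m with hGdef
  have hβ := measureReal_B_pos
  set β := volume.real B
  have hm' : (m : ℝ) ≤ n + 2 := by exact_mod_cast hm
  -- The worst case is `m = n + 2`, where the difference is `(n+3)² - (n+2)²`. This is where
  -- excluding the top order `n + 3` matters: there `κ` would be zero.
  have hκ : (2 * ((n : ℝ) + 2) + 1) ≤ ((((n + 1 : ℕ) : ℝ) + 2) ^ 2 - (m : ℝ) ^ 2) := by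
    push_cast
    nlinarith [(Nat.cast_nonneg m : (0 : ℝ) ≤ m)]
  have hκ0 : 0 < ((((n + 1 : ℕ) : ℝ) + 2) ^ 2 - (m : ℝ) ^ 2) := lt_of_lt_of_le (by positivity) hκ
  set κ := ((((n + 1 : ℕ) : ℝ) + 2) ^ 2 - (m : ℝ) ^ 2)
  set S := ∫ y in B, pd 0 G y * pd 0 G y with hS
  have hS0 : 0 ≤ S := integral_nonneg fun y => mul_self_nonneg _
  set C : ℝ := 27 * (9 / 4) ^ (n + 2) with hC
  have hC0 : 0 < C := by positivity
  -- The constant for which the pointwise bound on homogeneous harmonics reads `|∂₀G(y)| ≤ M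
  -- ‖y‖^(n+2)`; since the exponent is at least two, this is at most `M ‖y‖²` on the ball, whence
  -- the weight `p(s) = s`.
  set M := √(C * S / β) with hMdef
  have hM0 : 0 ≤ M := Real.sqrt_nonneg _
  have hM2 : M ^ 2 = C * S / β := Real.sq_sqrt (by positivity)
  have hM2' : M ^ 2 * β = C * S := by rw [hM2]; field_simp
  have hGc : ∀ i, ContDiff ℝ ∞ (pd i G) := fun i => contDiff_pd hG.contDiff (by simp) i
  have pt : ∀ i, ∀ {y : E3}, y ≠ 0 → pd i G y ^ 2 * β ≤
      C * (‖y‖ ^ (n + 2)) ^ 2 * ∫ z in B, pd i G z ^ 2 := fun i y hy =>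
    sq_mul_le_of_homogeneous (hGc i) (laplace_pd hG.contDiff hG.laplace i)
      (fun t ht z => pd_homogeneous (hG.contDiff.differentiable (by simp))
        (fun t ht z => potential_homogeneous θ (n + 2) m ht z) i ht z) hy
  have h2 := hG.setIntegral_eq (isHarmonicField_pd hG.contDiff hG.laplace)
    fun i => integrableOn_B_of_continuous (hGc i).continuous
  rw [← innerL2_self_of_conjGrad hP] at h2
  have hg0 := setIntegral_pd_eq_zero hG 0
  have hg00 : pd 0 G 0 = 0 := by
    have := setIntegral_eq_of_laplace (hGc 0) (laplace_pd hG.contDiff hG.laplace 0)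
    rw [hg0] at this
    exact (mul_eq_zero.1 this.symm).resolve_right hβ.ne'
  have hN := innerL2_self_nonneg P
  have hNS : innerL2 P P ≤ (n + 3) * S := by
    push_cast at h2
    have : (2 * ((n : ℝ) + 2) + 1) * innerL2 P P ≤ (2 * ((n : ℝ) + 2) + 1) * ((n + 3) * S) := by
      calc _ ≤ κ * innerL2 P P := by gcongr
        _ = _ := by rw [h2]; ring
    exact le_of_mul_le_mul_left this (by positivity)
  have hsum : innerL2 P P = ∑ i, ∫ z in B, pd i G z ^ 2 := by
    rw [innerL2_self_of_conjGrad hP]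
    simp only [← sq]
    exact integral_finsetSum _ fun i _ =>
      integrableOn_B_of_continuous ((hGc i).continuous.pow 2)
  have := norm_mul_abs_innerL2_le hf hb hG hκ0 hP hg0 (p := fun s => s) contDiff_id
    (M := M) (K := ((n : ℝ) + 7) / 4 * ‖x‖ ^ (n + 2)) (L := 81 / 5 * (9 / 4) ^ (n + 2)) (x := x)
    hM0 (by positivity) ?_ ?_ ?_
  · exact this
  · intro y hy
    have hy1 : ‖y‖ ≤ 1 := (mem_B.1 hy).le
    by_cases hy0 : y = 0
    · simp [hy0, hg00]
    have hle : |pd 0 G y| ≤ M * ‖y‖ ^ (n + 2) := by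
      refine abs_le_of_sq_le_sq ?_ (by positivity)
      have := pt 0 hy0
      refine le_of_mul_le_mul_right (this.trans (le_of_eq ?_)) hβ
      simp only [sq (pd 0 G _)]
      rw [← hS, mul_pow]
      linear_combination -((‖y‖ ^ (n + 2)) ^ 2) * hM2'
    refine hle.trans (mul_le_mul_of_nonneg_left ?_ hM0)
    exact pow_le_pow_of_le_one (norm_nonneg _) hy1 (by lia)
  · by_cases hx0 : x = 0
    · rw [hx0, hP0, norm_zero]
      positivity
    refine le_of_sq_le_sq ?_ (by positivity)
    refine le_of_mul_le_mul_right ?_ hβ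
    -- Replaces `√(n + 3)` by its tangent at `n = 1`; the difference of the two sides is `(n - 1)² /
    -- 16`.
    have h7 : ((n : ℝ) + 3) ≤ (((n : ℝ) + 7) / 4) ^ 2 := by nlinarith [sq_nonneg ((n : ℝ) - 1)]
    calc ‖P x‖ ^ 2 * β = ∑ i, pd i G x ^ 2 * β := by
          rw [hP x hx0, sq_norm_conjGrad, Finset.sum_mul]
      _ ≤ ∑ i, C * (‖x‖ ^ (n + 2)) ^ 2 * ∫ z in B, pd i G z ^ 2 :=
          Finset.sum_le_sum fun i _ => pt i hx0
      _ = C * (‖x‖ ^ (n + 2)) ^ 2 * innerL2 P P := by rw [← Finset.mul_sum, hsum]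
      _ ≤ C * (‖x‖ ^ (n + 2)) ^ 2 * ((((n : ℝ) + 7) / 4) ^ 2 * S) := by
          gcongr
          exact hNS.trans (by gcongr)
      _ = _ := by linear_combination -((((n : ℝ) + 7) / 4 * ‖x‖ ^ (n + 2)) ^ 2) * hM2'
  · rw [setIntegral_normSq]
    rw [← hS]
    refine le_of_eq ?_
    linear_combination 3 / 5 * hM2' + 3 / 5 * S * hC

/-- Fourier terms of degree one. -/
lemma norm_mul_abs_innerL2_le_of_one {f : E3 → ℍ[ℝ]} (hf : IsMonogenicOn f B)
    (hb : ∀ x ∈ B, ‖f x‖ < 1) {κ : ℝ} {G : E3 → ℝ} (hG : IsAxial (0 + 1) κ G) (hκ : 0 < κ)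
    {P : E3 → ℍ[ℝ]} (hP : ∀ x ≠ 0, P x = conjGrad G x) (hP0 : P 0 = 0) {c : ℝ} (hc : 0 ≤ c)
    (hle : ∀ y, ∑ i, pd i G y ^ 2 ≤ (c * ‖y‖) ^ 2) {i : Fin 3} (hg : ∀ y, pd 0 G y = c * y i)
    (x : E3) :
    ‖P x‖ * |innerL2 P f| ≤ ‖x‖ * 4 * (1 - |(f 0).re|) * innerL2 P P := by
  refine norm_mul_abs_innerL2_le hf hb hG hκ hP (setIntegral_pd_eq_zero hG 0)
    -- A polynomial in `‖y‖²` dominating `‖y‖`, as `2‖y‖ ≤ 1 + ‖y‖²`. The ratio of the integrals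
    -- `4/5` and `1/5` is the constant `4`.
    (p := fun s => (1 + s) / 2) (by fun_prop) hc (norm_nonneg x) ?_ ?_ ?_
  · intro y _
    rw [hg, abs_mul, abs_of_nonneg hc]
    gcongr
    have : |y i| ≤ ‖y‖ := PiLp.norm_apply_le y i
    nlinarith [sq_nonneg (‖y‖ - 1)]
  · by_cases hx0 : x = 0
    · simp [hx0, hP0]
    refine le_of_sq_le_sq ?_ (by positivity)
    rw [hP x hx0, sq_norm_conjGrad, mul_comm ‖x‖]
    exact hle x
  · have h1 : ∫ y in B, (1 + ‖y‖ ^ 2) / 2 = 4 / 5 * volume.real B := by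
      rw [integral_div, integral_add (integrableOn_B_of_continuous continuous_const)
        (integrableOn_B_of_continuous (by fun_prop)), setIntegral_normSq]
      simp
      ring
    have h2 : ∫ y in B, pd 0 G y * pd 0 G y = c ^ 2 * (1 / 5 * volume.real B) := by
      rw [← setIntegral_coord_sq i, ← integral_const_mul]
      congr 1
      funext y
      rw [hg]
      ring
    rw [h1, h2]
    exact le_of_eq (by ring)

/-! ### Degrees one and zero -/

lemma zonal_one_zero (x : E3) : zonal 1 0 x = x 0 := by
  simp [zonal, zonalAux, legendreDeriv_succ_succ, legendreDeriv_zero_zero, legendreDeriv_zero_succ]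

lemma zonal_one_one (x : E3) : zonal 1 1 x = 1 := by
  simp [zonal, zonalAux, legendreDeriv_succ_succ, legendreDeriv_zero_zero, legendreDeriv_zero_succ]

lemma XPoly_zero (n m : ℕ) : XPoly (n + 1) m 0 = 0 := by
  rw [XPoly, norm_zero, zero_pow n.succ_ne_zero, zero_smul]
  rfl

lemma YPoly_zero (n m : ℕ) : YPoly (n + 1) m 0 = 0 := by
  rw [YPoly, norm_zero, zero_pow n.succ_ne_zero, zero_smul]
  rfl

lemma zonal_one_two (x : E3) : zonal 1 2 x = 0 := by
  simp [zonal]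

lemma pd_potential_one_one (θ : ℂ) (x : E3) :
    pd 0 (potential θ 1 1) x = 3 / 2 * (x 1 * θ.re + x 2 * (Complex.I * θ).re) ∧
      pd 1 (potential θ 1 1) x = 3 / 2 * (x 0 * θ.re) ∧
      pd 2 (potential θ 1 1) x = 3 / 2 * (x 0 * (Complex.I * θ).re) := by
  have h1 := neg_pd_one_potential_succ θ 1 0 x
  have h2 := neg_pd_two_potential_succ θ 1 0 x
  simp only [zero_add, solid, zonal_one_two, zonal_one_zero, planar_zero, zero_mul] at h1 h2
  refine ⟨?_, ?_, ?_⟩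
  · rw [pd_zero_potential, solid, zonal_one_one, planar_succ, planar_zero, planar_zero]
    norm_num
  · norm_num at h1
    linarith
  · norm_num at h2 ⊢
    linarith

lemma norm_XPoly_one_zero_mul_le {f : E3 → ℍ[ℝ]} (hf : IsMonogenicOn f B)
    (hb : ∀ x ∈ B, ‖f x‖ < 1) (x : E3) :
    ‖XPoly 1 0 x‖ * |innerL2 (XPoly 1 0) f| ≤
      ‖x‖ * 4 * (1 - |(f 0).re|) * innerL2 (XPoly 1 0) (XPoly 1 0) := by
  have h0 : ∀ y, pd 0 (potential 1 1 0) y = 1 * y 0 := fun y => by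
    rw [pd_zero_potential, solid, zonal_one_zero, planar_zero]; norm_num
  refine norm_mul_abs_innerL2_le_of_one hf hb (isAxial_potential 1 0 0) (by norm_num)
    (fun x hx => XPoly_eq_conjGrad 1 0 hx) (XPoly_zero 0 0) zero_le_one ?_ h0 x
  intro y
  have h1 := neg_pd_potential_zero 1 1 (i := 1) (by simp) y
  have h2 := neg_pd_potential_zero 1 1 (i := 2) (by simp) y
  rw [zonal_one_one, Complex.one_re] at h1 h2
  rw [Fin.sum_univ_three, h0, ← neg_sq (pd 1 _ y), ← neg_sq (pd 2 _ y), h1, h2, one_mul, one_mul,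
    normSq_eq]
  nlinarith [sq_nonneg (y 1), sq_nonneg (y 2)]

lemma norm_XPoly_one_one_mul_le {f : E3 → ℍ[ℝ]} (hf : IsMonogenicOn f B)
    (hb : ∀ x ∈ B, ‖f x‖ < 1) (x : E3) :
    ‖XPoly 1 1 x‖ * |innerL2 (XPoly 1 1) f| ≤
      ‖x‖ * 4 * (1 - |(f 0).re|) * innerL2 (XPoly 1 1) (XPoly 1 1) := by
  have h := pd_potential_one_one 1
  simp only [Complex.one_re, mul_one, Complex.I_re, mul_zero, add_zero] at h
  refine norm_mul_abs_innerL2_le_of_one hf hb (isAxial_potential 1 0 1) (by norm_num)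
    (fun x hx => XPoly_eq_conjGrad 1 1 hx) (XPoly_zero 0 1) (c := 3 / 2) (by norm_num) ?_
    (fun y => (h y).1) x
  intro y
  rw [Fin.sum_univ_three, (h y).1, (h y).2.1, (h y).2.2, mul_pow _ ‖y‖, normSq_eq]
  nlinarith [sq_nonneg (y 2)]

lemma norm_YPoly_one_one_mul_le {f : E3 → ℍ[ℝ]} (hf : IsMonogenicOn f B)
    (hb : ∀ x ∈ B, ‖f x‖ < 1) (x : E3) :
    ‖YPoly 1 1 x‖ * |innerL2 (YPoly 1 1) f| ≤
      ‖x‖ * 4 * (1 - |(f 0).re|) * innerL2 (YPoly 1 1) (YPoly 1 1) := by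
  have h := pd_potential_one_one (-Complex.I)
  simp only [Complex.neg_re, Complex.I_re, neg_zero, mul_neg, Complex.I_mul_I, neg_neg,
    Complex.one_re, mul_zero, mul_one, zero_add] at h
  refine norm_mul_abs_innerL2_le_of_one hf hb (isAxial_potential (-Complex.I) 0 1) (by norm_num)
    (fun x hx => YPoly_eq_conjGrad 1 0 hx) (YPoly_zero 0 1) (c := 3 / 2) (by norm_num) ?_
    (fun y => (h y).1) x
  intro y
  rw [Fin.sum_univ_three, (h y).1, (h y).2.1, (h y).2.2, mul_pow _ ‖y‖, normSq_eq]
  nlinarith [sq_nonneg (y 1)]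

lemma XPoly_zero_zero (x : E3) : XPoly 0 0 x = ((1 / 2 : ℝ) : ℍ[ℝ]) := by
  have h1 : ∀ t, assocLegendre 0 1 t = 0 := fun t => by simp [assocLegendre, legendre]
  have h0 : ∀ t, assocLegendre 0 0 t = 1 := fun t => by simp [assocLegendre, legendre]
  rw [XPoly, pow_zero, one_smul]
  ext <;> simp only [Quaternion.re_coe, Quaternion.imI_coe, Quaternion.imJ_coe,
    Quaternion.imK_coe] <;> simp [h0, h1, chebT]

/-- The polynomial is the constant `1/2`, so by the mean value property of the scalar part this is
in fact an equality. -/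
lemma norm_XPoly_zero_zero_mul_le {f : E3 → ℍ[ℝ]} (hf : IsMonogenicOn f B)
    (hb : ∀ x ∈ B, ‖f x‖ < 1) (x : E3) :
    ‖XPoly 0 0 x‖ * |innerL2 (XPoly 0 0) f| ≤
      |(f 0).re| * innerL2 (XPoly 0 0) (XPoly 0 0) := by
  have hF := hf.isHarmonicField
  have hmv := setIntegral_mean_value (hF.contDiffOn 0) (hF.weaklyHarmonic 0)
    (hf.integrableOn_conjField hb 0)
  have hre : ∀ q : ℍ[ℝ], (star ((1 / 2 : ℝ) : ℍ[ℝ]) * q).re = 1 / 2 * q.re := fun q => by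
    rw [Quaternion.star_coe, Quaternion.re_mul]
    simp only [Quaternion.re_coe, Quaternion.imI_coe, Quaternion.imJ_coe,
      Quaternion.imK_coe]
    ring
  have h1 : innerL2 (XPoly 0 0) f = 1 / 2 * ((f 0).re * volume.real B) := by
    unfold innerL2
    simp only [XPoly_zero_zero, hre]
    rw [integral_const_mul]
    exact congrArg _ hmv
  have h2 : innerL2 (XPoly 0 0) (XPoly 0 0) = 1 / 4 * volume.real B := by
    unfold innerL2
    simp only [XPoly_zero_zero, hre, Quaternion.re_coe]
    simp
    ring
  have h3 : ‖XPoly 0 0 x‖ = 1 / 2 := by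
    refine (sq_eq_sq₀ (norm_nonneg _) (by norm_num)).1 ?_
    rw [XPoly_zero_zero, sq_norm_eq]
    simp only [Quaternion.re_coe, Quaternion.imI_coe, Quaternion.imJ_coe,
      Quaternion.imK_coe]
    ring
  rw [h1, h2, h3, abs_mul, abs_mul, abs_of_pos measureReal_B_pos, abs_of_pos one_half_pos]
  exact le_of_eq (by ring)

/-! ### Summation over all degrees -/

lemma one_sub_abs_re_pos {f : E3 → ℍ[ℝ]} (hb : ∀ x ∈ B, ‖f x‖ < 1) : 0 < 1 - |(f 0).re| :=
  sub_pos.2 ((abs_conjField_le f 0 0).trans_lt (hb 0 (by simp [B])))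

lemma bohrTerm_nonneg (f : E3 → ℍ[ℝ]) (x : E3) (n : ℕ) : 0 ≤ bohrTerm f x n := by
  unfold bohrTerm
  positivity

lemma bohrTerm_zero_le {f : E3 → ℍ[ℝ]} (hf : IsMonogenicOn f B) (hb : ∀ x ∈ B, ‖f x‖ < 1)
    (x : E3) : bohrTerm f x 0 ≤ |(f 0).re| := by
  unfold bohrTerm
  rw [Finset.Icc_eq_empty (by simp), Finset.sum_empty, add_zero]
  exact norm_normalized_mul_le (abs_nonneg _) (norm_XPoly_zero_zero_mul_le hf hb x)

lemma bohrTerm_one_le {f : E3 → ℍ[ℝ]} (hf : IsMonogenicOn f B) (hb : ∀ x ∈ B, ‖f x‖ < 1)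
    (x : E3) : bohrTerm f x 1 ≤ 12 * ‖x‖ * (1 - |(f 0).re|) := by
  have h0 : 0 ≤ ‖x‖ * 4 * (1 - |(f 0).re|) :=
    mul_nonneg (by positivity) (one_sub_abs_re_pos hb).le
  have h1 := norm_normalized_mul_le h0 (norm_XPoly_one_zero_mul_le hf hb x)
  have h2 := norm_normalized_mul_le h0 (norm_XPoly_one_one_mul_le hf hb x)
  have h3 := norm_normalized_mul_le h0 (norm_YPoly_one_one_mul_le hf hb x)
  unfold bohrTerm coeffA coeffB XStar YStar
  rw [Finset.Icc_self, Finset.sum_singleton]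
  linarith

/-- Absorbs the number `2n + 5` of terms in degree `n + 2` and the linear factor of each into a
geometric one. The ratio `5/3` joins the `9/4` of the pointwise bound to give `15/4`. -/
lemma two_mul_add_five_mul_le (n : ℕ) :
    (2 * (n : ℝ) + 5) * (((n : ℝ) + 7) / 4) ≤ 7 / 2 * (5 / 3) ^ (n + 2) := by
  induction n with
  | zero => norm_num
  | succ n ih =>
    have hn : (0 : ℝ) ≤ n := n.cast_nonneg
    rw [show n + 1 + 2 = (n + 2) + 1 from rfl, pow_succ]
    push_cast
    nlinarith

lemma bohrTerm_add_two_le {f : E3 → ℍ[ℝ]} (hf : IsMonogenicOn f B) (hb : ∀ x ∈ B, ‖f x‖ < 1)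
    (x : E3) (n : ℕ) : bohrTerm f x (n + 2) ≤
      567 / 10 * (1 - |(f 0).re|) * (15 / 4 * ‖x‖) ^ (n + 2) := by
  have hu := (one_sub_abs_re_pos hb).le
  set b := ((n : ℝ) + 7) / 4 * ‖x‖ ^ (n + 2) * (81 / 5 * (9 / 4) ^ (n + 2))
      * (1 - |(f 0).re|) with hbdef
  have h0 : 0 ≤ b := mul_nonneg (by positivity) hu
  have hX : ∀ m ≤ n + 2, ‖XStar (n + 2) m x‖ * |coeffA f (n + 2) m| ≤ b := fun m hm =>
    norm_normalized_mul_le h0 (norm_mul_abs_innerL2_le_of_two_le hf hb 1 hm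
      (fun y hy => XPoly_eq_conjGrad (n + 2) m hy) (XPoly_zero (n + 1) m) x)
  have hY : ∀ m ∈ Finset.Icc 1 (n + 2), ‖YStar (n + 2) m x‖ * |coeffB f (n + 2) m| ≤ b := by
    intro m hm
    obtain ⟨h1, h2⟩ := Finset.mem_Icc.1 hm
    obtain ⟨p, rfl⟩ := Nat.exists_eq_add_of_le' h1
    exact norm_normalized_mul_le h0 (norm_mul_abs_innerL2_le_of_two_le hf hb (-Complex.I) h2
      (fun y hy => YPoly_eq_conjGrad (n + 2) p hy) (YPoly_zero (n + 1) (p + 1)) x)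
  have hs : bohrTerm f x (n + 2) ≤ b + ∑ m ∈ Finset.Icc 1 (n + 2), (b + b) :=
    add_le_add (hX 0 (Nat.zero_le _)) (Finset.sum_le_sum fun m hm =>
      add_le_add (hX m (Finset.mem_Icc.1 hm).2) (hY m hm))
  rw [Finset.sum_const, Nat.card_Icc, nsmul_eq_mul] at hs
  calc bohrTerm f x (n + 2) ≤ (2 * (n : ℝ) + 5) * b := by
        refine hs.trans (le_of_eq ?_)
        push_cast
        ring
    _ = (2 * (n : ℝ) + 5) * (((n : ℝ) + 7) / 4) * (81 / 5 * (1 - |(f 0).re|) *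
          ((9 / 4) ^ (n + 2) * ‖x‖ ^ (n + 2))) := by rw [hbdef]; ring
    _ ≤ 7 / 2 * (5 / 3) ^ (n + 2) * (81 / 5 * (1 - |(f 0).re|) *
          ((9 / 4) ^ (n + 2) * ‖x‖ ^ (n + 2))) :=
        mul_le_mul_of_nonneg_right (two_mul_add_five_mul_le n)
          (mul_nonneg (by positivity) (by positivity))
    _ = 567 / 10 * (1 - |(f 0).re|) * (((5 / 3) ^ (n + 2) * (9 / 4) ^ (n + 2)) *
          ‖x‖ ^ (n + 2)) := by ring
    _ = _ := by rw [← mul_pow, ← mul_pow]; norm_num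

end RieszBohr

end

theorem theorem4p1 (f : RieszBohr.E3 → Quaternion ℝ)
    (hf : RieszBohr.IsMonogenicOn f RieszBohr.B)
    (hbound : ∀ x ∈ RieszBohr.B, ‖f x‖ < 1)
    (horth : RieszBohr.OrthogonalToConstants (fun x => f x - f 0))
    (r : ℝ) (hr0 : 0 ≤ r) (hr : r < 0.026)
    (x : RieszBohr.E3) (hx : ‖x‖ ≤ r) :
    Summable (RieszBohr.bohrTerm f x) ∧ ∑' n : ℕ, RieszBohr.bohrTerm f x n < 1 := by
  have hu := RieszBohr.one_sub_abs_re_pos hbound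
  have hb0 := RieszBohr.bohrTerm_zero_le hf hbound x
  have hb1 := RieszBohr.bohrTerm_one_le hf hbound x
  set d := 1 - |(f 0).re| with hd
  have hxr : ‖x‖ ≤ 0.026 := hx.trans hr.le
  -- `0.0975 = (15/4) · 0.026` is the ratio of the dominating geometric series.
  have hq : 15 / 4 * ‖x‖ ≤ 0.0975 := by linarith
  have hq0 : 0 ≤ 15 / 4 * ‖x‖ := by positivity
  have hle : ∀ n, RieszBohr.bohrTerm f x (n + 2) ≤
      567 / 10 * d * 0.0975 ^ 2 * 0.0975 ^ n := fun n => by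
    refine (RieszBohr.bohrTerm_add_two_le hf hbound x n).trans ?_
    rw [mul_assoc (567 / 10 * d), ← pow_add, add_comm 2 n]
    gcongr
  have hgeo : HasSum (fun n : ℕ => 567 / 10 * d * 0.0975 ^ 2 * (0.0975 : ℝ) ^ n)
      (567 / 10 * d * 0.0975 ^ 2 * (1 - 0.0975)⁻¹) :=
    (hasSum_geometric_of_lt_one (by norm_num) (by norm_num)).mul_left _
  have hsum2 : Summable fun n => RieszBohr.bohrTerm f x (n + 2) :=
    hgeo.summable.of_nonneg_of_le (fun n => RieszBohr.bohrTerm_nonneg f x _) hle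
  have hsum : Summable (RieszBohr.bohrTerm f x) := (summable_nat_add_iff 2).1 hsum2
  refine ⟨hsum, ?_⟩
  rw [← hsum.sum_add_tsum_nat_add 2, Finset.sum_range_succ, Finset.sum_range_one]
  have ht := hsum2.tsum_le_tsum hle hgeo.summable
  rw [hgeo.tsum_eq] at ht
  have h1 : 12 * ‖x‖ * d ≤ 0.312 * d := by
    gcongr
    linarith
  -- The coefficients of `d` are `0.312` from degree one and `56.7 · 0.0975² / 0.9025 < 0.598` from
  -- the tail; their sum is below `1`, and `d > 0` makes the final inequality strict.
  norm_num at ht h1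
  linarith
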